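/- **Setting.** Let $A\in\mathbb R^{d_x\times d_x}$, $B\in\mathbb R^{d_x\times d_u}$, $d=\max(d_x,d_u)$, and consider the known linear dynamical system $x_1=0$, $x_{t+1}=Ax_t+Bu_t+w_t$ ($t\ge 1$); $\|\cdot\|$ is the Euclidean norm of vectors and the spectral norm of matrices. Let $\kappa\ge 1$, $0<\gamma<1$, $\sigma>0$, $\alpha>0$ and $T\ge 1$. Assume: * $\|B\|\le\kappa_B$; the noise vectors $w_t$ are i.i.d. with law $\mathcal D$, $\mathbb E[w_t]=0$, $\mathbb E[w_tw_t^\top]\succeq\sigma^2I$, and $\|w_t\|\le W$ almost surely. * The (fixed, deterministic) cost functions $c_1,\dots,c_T:\mathbb R^{d_x}\times\mathbb R^{d_u}\to\mathbb R$ are differentiable and $\alpha$-strongly convex, and for every $D$ and all $\|x\|,\|u\|\le D$ one has $\|\nabla_xc_t(x,u)\|,\|\nabla_uc_t(x,u)\|\le GD$. A matrix $K\in\mathbb R^{d_u\times d_x}$ is $(\kappa,\gamma)$-diagonal strongly stable if $A-BK=QLQ^{-1}$ for a complex diagonal matrix $L$ and a non-singular complex matrix $Q$ with $\|L\|\le 1-\gamma$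 and $\|K\|,\|Q\|,\|Q^{-1}\|\le\kappa$. Let $\mathcal K$ be the set of these matrices. For a controller $\mathcal A$ put $J_T(\mathcal A)=\mathbb E\big[\sum_{t=1}^Tc_t(x_t,u_t)\big]$, and write $J_T(K)$ for the cost of $u_t=-Kx_t$. **Algorithm.** Fix $\mathbb K\in\mathcal K$, put $H=\lceil\gamma^{-1}\log(T\kappa^2)\rceil$, $\tilde A=A-B\mathbb K$ and $$\mathcal M=\Big\{M=(M^{[0]},\dots,M^{[H-1]}),\ M^{[i]}\in\mathbb R^{d_u\times d_x}:\ \|M^{[i-1]}\|\le\max\big(\kappa^3\kappa_B(1-\gamma)^i,\ 2\kappa^3(1-\gamma)^{i-1}\big),\ 1\le i\le H\Big\}.$$ With $w_0,\dots,w_{2H}$ here denoting independent vectors of law $\mathcal D$, put $$\Psi_i(M)=\tilde A^i\mathbf 1_{i\le H}+\sum_{j=0}^H\tilde A^jBM^{[i-j-1]}\mathbf 1_{1\le i-j\le H},\qquad y(M)=\sum_{i=0}^{2H}\Psi_i(M)\,w_{2H-i},$$ $$v(M)=-\mathbb Ky(M)+\sum_{i=1}^HM^{[i-1]}w_{2H+1-i},\qquad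 f_t(M)=\mathbb E\big[c_t(y(M),v(M))\big].$$ Starting from an arbitrary $M_1\in\mathcal M$, the algorithm $\mathcal A$ plays $u_t=-\mathbb Kx_t+\sum_{i=1}^HM_t^{[i-1]}w_{t-i}$ (with $w_s=0$ for $s<1$) and updates $M_{t+1}=\Pi_{\mathcal M}\big(M_t-\eta_t\nabla f_t(M_t)\big)$, where gradient and nearest-point projection $\Pi_{\mathcal M}$ refer to the Euclidean (Frobenius) structure on the entries of $M$. **Theorem.** There are two universal polynomials $p,q$ in four variables such that, in the above setting, for every $\theta\ge p(\gamma^{-1},\kappa_B,\kappa,d)$, every $\mathbb K\in\mathcal K$ and every $M_1\in\mathcal M$, the algorithm with step sizes $\eta_t=\theta/(\alpha\sigma^2t)$ satisfies $$J_T(\mathcal A)-J_T(K)\ \le\ q(\gamma^{-1},\kappa_B,\kappa,d)\;\theta\;\frac{G^2W^4}{\alpha\sigma^2}\,\log^7T\qquad\text{for every }K\in\mathcal K .$$ In particular, for $\theta=p(\gamma^{-1},\kappa_B,\kappa,d)$, the regret against the best controller in $\mathcal K$ is $O\big(\tfrac{G^2W^4}{\alpha\sigma^2}\log^7T\big)$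 up to factors polynomial in $\gamma^{-1},\kappa_B,\kappa,d$. -/

import Mathlib

open MeasureTheory ProbabilityTheory
open scoped Matrix

noncomputable section

namespace OnlineControl

/-- The spectral norm: the operator norm with respect to the Euclidean norms. -/
def specNorm {𝕜 : Type*} [RCLike 𝕜] {m n : ℕ} (A : Matrix (Fin m) (Fin n) 𝕜) : ℝ :=
  ‖(Matrix.toEuclideanLin A).toContinuousLinearMap‖

/-- `(κ, γ)`-diagonal strong stability of the linear policy `u = -K x` for the dynamics `(A, B)`:
`A - B K = Q L Q⁻¹` with `L` complex diagonal and `Q` complex and non-singular. -/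
def DiagStronglyStable {dx du : ℕ} (A : Matrix (Fin dx) (Fin dx) ℝ)
    (B : Matrix (Fin dx) (Fin du) ℝ) (κ γ : ℝ) (K : Matrix (Fin du) (Fin dx) ℝ) : Prop :=
  ∃ (l : Fin dx → ℂ) (Q : Matrix (Fin dx) (Fin dx) ℂ),
    IsUnit Q ∧
    (A - B * K).map (algebraMap ℝ ℂ) = Q * Matrix.diagonal l * Q⁻¹ ∧
    specNorm (Matrix.diagonal l) ≤ 1 - γ ∧
    specNorm K ≤ κ ∧ specNorm Q ≤ κ ∧ specNorm Q⁻¹ ≤ κ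

/-- The noise distribution has mean zero, covariance at least `σ² I`, and is bounded by `W`. -/
structure NoiseLaw {dx : ℕ} (𝒟 : Measure (EuclideanSpace ℝ (Fin dx))) (σ W : ℝ) : Prop where
  prob : IsProbabilityMeasure 𝒟
  mean_zero : ∫ x, x ∂𝒟 = 0
  cov : (Matrix.of (fun i j : Fin dx => ∫ x, x i * x j ∂𝒟) -
    σ ^ 2 • (1 : Matrix (Fin dx) (Fin dx) ℝ)).PosSemidef
  bounded : ∀ᵐ x ∂𝒟, ‖x‖ ≤ W

/-- The cost is differentiable, `α`-strongly convex in `(x, u)` for the Euclidean norm, and its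
partial gradients are at most `G D` on `‖x‖, ‖u‖ ≤ D`, for every `D`. -/
structure CostClass {dx du : ℕ} (α G : ℝ)
    (c : EuclideanSpace ℝ (Fin dx) → EuclideanSpace ℝ (Fin du) → ℝ) : Prop where
  diff : Differentiable ℝ
    (fun z : EuclideanSpace ℝ (Fin dx) × EuclideanSpace ℝ (Fin du) => c z.1 z.2)
  strong : StrongConvexOn Set.univ α
    (fun z : WithLp 2 (EuclideanSpace ℝ (Fin dx) × EuclideanSpace ℝ (Fin du)) => c z.fst z.snd)
  grad_x : ∀ (D : ℝ) (x : EuclideanSpace ℝ (Fin dx)) (u : EuclideanSpace ℝ (Fin du)),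
    ‖x‖ ≤ D → ‖u‖ ≤ D → ‖gradient (fun x' => c x' u) x‖ ≤ G * D
  grad_u : ∀ (D : ℝ) (x : EuclideanSpace ℝ (Fin dx)) (u : EuclideanSpace ℝ (Fin du)),
    ‖x‖ ≤ D → ‖u‖ ≤ D → ‖gradient (fun u' => c x u') u‖ ≤ G * D

/-- Parameters `M = (M^[0], …, M^[H-1])` of a disturbance-action policy, as one flattened vector;
norm, gradient and projection are those of this Euclidean space. -/
abbrev Params (H du dx : ℕ) : Type := EuclideanSpace ℝ (Fin H × Fin du × Fin dx)

/-- The matrix `M^[i]`, and `0` if `i ≥ H`. -/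
def blk {H du dx : ℕ} (M : Params H du dx) (i : ℕ) : Matrix (Fin du) (Fin dx) ℝ :=
  if h : i < H then Matrix.of (fun a b => M (⟨i, h⟩, a, b)) else 0

/-- The horizon `γ⁻¹ log (T κ²)`, rounded up. -/
def horizon (κ γ : ℝ) (T : ℕ) : ℕ := ⌈γ⁻¹ * Real.log (T * κ ^ 2)⌉₊

/-- The feasible set of the parameters. The bound on the `i`-th block (`1 ≤ i ≤ H`) is
`max (κ³ κ_B (1 - γ)^i) (2 κ³ (1 - γ)^(i-1))`; blocks are counted from `0` here. -/
def feasible (H du dx : ℕ) (κB κ γ : ℝ) : Set (Params H du dx) :=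
  {M | ∀ i < H, specNorm (blk M i) ≤
    max (κ ^ 3 * κB * (1 - γ) ^ (i + 1)) (2 * κ ^ 3 * (1 - γ) ^ i)}

section System

variable {dx du : ℕ} (A : Matrix (Fin dx) (Fin dx) ℝ) (B : Matrix (Fin dx) (Fin du) ℝ)

/-- The states of `x_{t+1} = A x_t + B u_t + w_t` from `x_1 = 0` (time starts at `1`), where
`u_t = π t x_t`. -/
def states (π : ℕ → EuclideanSpace ℝ (Fin dx) → EuclideanSpace ℝ (Fin du))
    (w : ℕ → EuclideanSpace ℝ (Fin dx)) : ℕ → EuclideanSpace ℝ (Fin dx)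
  | 0 => 0
  | 1 => 0
  | t + 2 => A.toEuclideanLin (states π w (t + 1))
      + B.toEuclideanLin (π (t + 1) (states π w (t + 1))) + w (t + 1)

/-- The linear controller `u = -K x`. -/
def linearPolicy (K : Matrix (Fin du) (Fin dx) ℝ) (_t : ℕ) (x : EuclideanSpace ℝ (Fin dx)) :
    EuclideanSpace ℝ (Fin du) :=
  -K.toEuclideanLin x

/-- The disturbance-action controller with parameters `M t` at time `t`:
`u_t = -𝕂 x_t + ∑_{i=1}^H M_t^[i-1] w_{t-i}`, with `w_s = 0` before the start (`s < 1`). -/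
def dapPolicy {H : ℕ} (𝕂 : Matrix (Fin du) (Fin dx) ℝ) (M : ℕ → Params H du dx)
    (w : ℕ → EuclideanSpace ℝ (Fin dx)) (t : ℕ) (x : EuclideanSpace ℝ (Fin dx)) :
    EuclideanSpace ℝ (Fin du) :=
  -𝕂.toEuclideanLin x + ∑ i ∈ Finset.Icc 1 H,
    if i < t then (blk (M t) (i - 1)).toEuclideanLin (w (t - i)) else 0

/-- The expected total cost `E [∑_{t=1}^T c_t(x_t, u_t)]` of the controller `π`, which may depend on
the noise sequence. -/
def expectedCost {Ω : Type*} [MeasurableSpace Ω] (P : Measure Ω)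
    (w : ℕ → Ω → EuclideanSpace ℝ (Fin dx))
    (c : ℕ → EuclideanSpace ℝ (Fin dx) → EuclideanSpace ℝ (Fin du) → ℝ) (T : ℕ)
    (π : (ℕ → EuclideanSpace ℝ (Fin dx)) → ℕ → EuclideanSpace ℝ (Fin dx) →
      EuclideanSpace ℝ (Fin du)) : ℝ :=
  ∫ ω, ∑ t ∈ Finset.Icc 1 T,
    (let v : ℕ → EuclideanSpace ℝ (Fin dx) := fun s => w s ω
     let x := states A B (π v) v t
     c t x (π v t x)) ∂P

variable (𝕂 : Matrix (Fin du) (Fin dx) ℝ)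

/-- The disturbance-state transfer matrix `Ψ_i(M_{0:H})`, for `0 ≤ i ≤ 2H`. -/
def transfer {H : ℕ} (M : ℕ → Params H du dx) (i : ℕ) : Matrix (Fin dx) (Fin dx) ℝ :=
  (if i ≤ H then (A - B * 𝕂) ^ i else 0) +
    ∑ j ∈ Finset.range (H + 1),
      if j + 1 ≤ i ∧ i ≤ j + H then (A - B * 𝕂) ^ j * B * blk (M (H - j)) (i - j - 1) else 0

/-- The surrogate state `y(M_{0:H}) = ∑_{i=0}^{2H} Ψ_i(M_{0:H}) w_{2H-i}`. -/
def surrogateState {H : ℕ} (M : ℕ → Params H du dx)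
    (w : Fin (2 * H + 1) → EuclideanSpace ℝ (Fin dx)) : EuclideanSpace ℝ (Fin dx) :=
  ∑ i : Fin (2 * H + 1), (transfer A B 𝕂 M i).toEuclideanLin (w i.rev)

/-- The surrogate action
`v(M_{0:H+1}) = -𝕂 y(M_{0:H}) + ∑_{i=1}^H M_{H+1}^[i-1] w_{2H+1-i}`. -/
def surrogateAction {H : ℕ} (M : ℕ → Params H du dx)
    (w : Fin (2 * H + 1) → EuclideanSpace ℝ (Fin dx)) : EuclideanSpace ℝ (Fin du) :=
  -𝕂.toEuclideanLin (surrogateState A B 𝕂 M w) +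
    ∑ i : Fin H, (blk (M (H + 1)) i).toEuclideanLin (w (Fin.rev ⟨i, by omega⟩))

/-- The surrogate cost `f(M) = E [c(y(M, …, M), v(M, …, M))]` over independent noise vectors with
law `𝒟`. -/
def surrogateCost {H : ℕ} (𝒟 : Measure (EuclideanSpace ℝ (Fin dx)))
    (c : EuclideanSpace ℝ (Fin dx) → EuclideanSpace ℝ (Fin du) → ℝ) (M : Params H du dx) : ℝ :=
  ∫ w, c (surrogateState A B 𝕂 (fun _ => M) w) (surrogateAction A B 𝕂 (fun _ => M) w)
    ∂(Measure.pi fun _ : Fin (2 * H + 1) => 𝒟)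

/-- `M_1, …, M_T` are iterates of projected online gradient descent on the surrogate costs with
step sizes `η_t`: `M_1` is an arbitrary feasible point and `M_{t+1}` is the point of the feasible
set nearest to `M_t - η_t ∇ f_t(M_t)`. -/
def IsGradientRun {H : ℕ} (κB κ γ : ℝ) (𝒟 : Measure (EuclideanSpace ℝ (Fin dx)))
    (c : ℕ → EuclideanSpace ℝ (Fin dx) → EuclideanSpace ℝ (Fin du) → ℝ) (T : ℕ) (η : ℕ → ℝ)
    (M : ℕ → Params H du dx) : Prop :=
  M 1 ∈ feasible H du dx κB κ γ ∧
  ∀ t, 1 ≤ t → t < T →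
    M (t + 1) ∈ feasible H du dx κB κ γ ∧
    dist (M t - η t • gradient (surrogateCost A B 𝕂 𝒟 (c t)) (M t)) (M (t + 1)) =
      Metric.infDist (M t - η t • gradient (surrogateCost A B 𝕂 𝒟 (c t)) (M t))
        (feasible H du dx κB κ γ)

end System

end OnlineControl

end

/-!
The closed-loop matrix `A - B 𝕂` has geometrically decaying powers, so up to an error of order `1/T`
the cost of step `t` depends on the last `2 H` noise vectors and on parameters that have moved by
`O(log T / t)` only; this is the surrogate cost `f_t (M_t)`. Unrolling the dynamics under a linear
policy `u = -K x` shows that it is imitated, up to an error of order `1/T`, by one feasible `M`.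
So it remains to bound the regret of gradient descent on the surrogate costs, which is logarithmic
because they are strongly convex. For this, a change `N` of the parameters with zero-mean
independent noise changes state and action by the random vectors `Y` and `-𝕂 Y + ∑ N^[i] w_{t-i}`,
and since `‖𝕂‖ ≤ κ`, their second moments together are at least
`(2 κ²)⁻¹ E ‖∑ N^[i] w_{t-i}‖² ≥ σ² ‖N‖² / (2 κ²)`.
-/

noncomputable section

namespace OnlineControl

section SpecNorm

variable {𝕜 : Type*} [RCLike 𝕜] {l m n : ℕ}

lemma specNorm_nonneg (A : Matrix (Fin m) (Fin n) 𝕜) : 0 ≤ specNorm A := norm_nonneg _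

lemma norm_toEuclideanLin_le {A : Matrix (Fin m) (Fin n) 𝕜} {C : ℝ} (h : specNorm A ≤ C)
    (x : EuclideanSpace 𝕜 (Fin n)) : ‖A.toEuclideanLin x‖ ≤ C * ‖x‖ :=
  A.toEuclideanLin.toContinuousLinearMap.le_of_opNorm_le h x

lemma specNorm_le {A : Matrix (Fin m) (Fin n) 𝕜} {C : ℝ} (hC : 0 ≤ C)
    (h : ∀ x, ‖A.toEuclideanLin x‖ ≤ C * ‖x‖) : specNorm A ≤ C :=
  ContinuousLinearMap.opNorm_le_bound _ hC h

lemma toEuclideanLin_mul_apply (A : Matrix (Fin l) (Fin m) 𝕜) (B : Matrix (Fin m) (Fin n) 𝕜)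
    (x : EuclideanSpace 𝕜 (Fin n)) :
    (A * B).toEuclideanLin x = A.toEuclideanLin (B.toEuclideanLin x) := by
  simp

lemma specNorm_add_le (A B : Matrix (Fin m) (Fin n) 𝕜) :
    specNorm (A + B) ≤ specNorm A + specNorm B := by
  simpa only [specNorm, map_add] using norm_add_le _ _

lemma specNorm_sub_le (A B : Matrix (Fin m) (Fin n) 𝕜) :
    specNorm (A - B) ≤ specNorm A + specNorm B := by
  simpa only [specNorm, map_sub] using norm_sub_le _ _

lemma specNorm_smul (c : 𝕜) (A : Matrix (Fin m) (Fin n) 𝕜) :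
    specNorm (c • A) = ‖c‖ * specNorm A := by
  simp only [specNorm, map_smul, norm_smul]

lemma specNorm_mul_le (A : Matrix (Fin l) (Fin m) 𝕜) (B : Matrix (Fin m) (Fin n) 𝕜) :
    specNorm (A * B) ≤ specNorm A * specNorm B := by
  refine specNorm_le (mul_nonneg (specNorm_nonneg A) (specNorm_nonneg B)) fun x => ?_
  rw [toEuclideanLin_mul_apply, mul_assoc]
  exact (norm_toEuclideanLin_le le_rfl _).trans
    (mul_le_mul_of_nonneg_left (norm_toEuclideanLin_le le_rfl x) (specNorm_nonneg A))

lemma specNorm_one_le : specNorm (1 : Matrix (Fin n) (Fin n) 𝕜) ≤ 1 :=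
  specNorm_le zero_le_one fun x => by simp

lemma specNorm_pow_le (A : Matrix (Fin n) (Fin n) 𝕜) (i : ℕ) :
    specNorm (A ^ i) ≤ specNorm A ^ i := by
  induction i with
  | zero => simpa only [pow_zero] using specNorm_one_le
  | succ i ih =>
    rw [pow_succ, pow_succ]
    exact (specNorm_mul_le _ _).trans (mul_le_mul_of_nonneg_right ih (specNorm_nonneg A))

lemma specNorm_le_frobenius (A : Matrix (Fin m) (Fin n) 𝕜) :
    specNorm A ≤ √(∑ a, ∑ b, ‖A a b‖ ^ 2) := by
  refine specNorm_le (Real.sqrt_nonneg _) fun x => ?_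
  rw [EuclideanSpace.norm_eq, EuclideanSpace.norm_eq, ← Real.sqrt_mul (by positivity),
    Finset.sum_mul]
  refine Real.sqrt_le_sqrt (Finset.sum_le_sum fun a _ => ?_)
  calc ‖A.toEuclideanLin x a‖ ^ 2 ≤ (∑ b, ‖A a b‖ * ‖x b‖) ^ 2 := by
        gcongr
        change ‖∑ b, A a b * x b‖ ≤ _
        exact norm_sum_le_of_le _ fun b _ => norm_mul_le _ _
    _ ≤ (∑ b, ‖A a b‖ ^ 2) * ∑ b, ‖x b‖ ^ 2 := Finset.sum_mul_sq_le_sq_mul_sq _ _ _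

lemma specNorm_le_specNorm_map_ofReal (A : Matrix (Fin m) (Fin n) ℝ) :
    specNorm A ≤ specNorm (A.map (algebraMap ℝ ℂ)) := by
  refine specNorm_le (specNorm_nonneg _) fun x => ?_
  have norm_ofReal {k : ℕ} (y : EuclideanSpace ℝ (Fin k)) :
      ‖(WithLp.toLp 2 fun i => (y i : ℂ) : EuclideanSpace ℂ (Fin k))‖ = ‖y‖ := by
    simp [EuclideanSpace.norm_eq]
  have toEuclideanLin_ofReal : (WithLp.toLp 2 fun i => (A.toEuclideanLin x i : ℂ)) =
      (A.map (algebraMap ℝ ℂ)).toEuclideanLin (WithLp.toLp 2 fun i => (x i : ℂ)) := by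
    ext i
    simp [Matrix.mulVec, dotProduct]
  rw [← norm_ofReal, ← norm_ofReal x, toEuclideanLin_ofReal]
  exact norm_toEuclideanLin_le le_rfl _

end SpecNorm

section Stability

variable {dx du : ℕ} {A : Matrix (Fin dx) (Fin dx) ℝ} {B : Matrix (Fin dx) (Fin du) ℝ}
  {κ γ : ℝ} {K : Matrix (Fin du) (Fin dx) ℝ}

/-- Exponential stability of the linear policy `u = -K x`: the powers of the closed-loop matrix
decay like `κ² (1 - γ)^i`. Unlike diagonal strong stability it does not ask for a diagonalization,
and it is all that the regret analysis needs. -/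
structure PowerStable (A : Matrix (Fin dx) (Fin dx) ℝ) (B : Matrix (Fin dx) (Fin du) ℝ)
    (κ γ : ℝ) (K : Matrix (Fin du) (Fin dx) ℝ) : Prop where
  specNorm_gain_le : specNorm K ≤ κ
  specNorm_pow_le : ∀ i, specNorm ((A - B * K) ^ i) ≤ κ ^ 2 * (1 - γ) ^ i

/-- The closed-loop map `x ↦ (A - B K) x` of the linear policy `u = -K x`. -/
abbrev closedLoop (A : Matrix (Fin dx) (Fin dx) ℝ) (B : Matrix (Fin dx) (Fin du) ℝ)
    (K : Matrix (Fin du) (Fin dx) ℝ) :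
    EuclideanSpace ℝ (Fin dx) →ₗ[ℝ] EuclideanSpace ℝ (Fin dx) :=
  (A - B * K).toEuclideanLin

lemma PowerStable.norm_pow_le (h : PowerStable A B κ γ K) (i : ℕ)
    (z : EuclideanSpace ℝ (Fin dx)) :
    ‖(closedLoop A B K ^ i) z‖ ≤ κ ^ 2 * (1 - γ) ^ i * ‖z‖ := by
  rw [closedLoop, ← Matrix.toLpLin_pow]
  exact norm_toEuclideanLin_le (h.specNorm_pow_le i) z

lemma DiagStronglyStable.powerStable (h : DiagStronglyStable A B κ γ K) :
    PowerStable A B κ γ K := by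
  obtain ⟨l, Q, hQ, hA, hl, hK, hQn, hQi⟩ := h
  refine ⟨hK, fun i => (specNorm_le_specNorm_map_ofReal _).trans ?_⟩
  have pow_eq : ((A - B * K) ^ i).map (algebraMap ℝ ℂ) = Q * Matrix.diagonal l ^ i * Q⁻¹ := by
    obtain ⟨U, rfl⟩ := hQ
    rw [← Matrix.coe_units_inv] at hA ⊢
    rw [← Units.conj_pow, ← hA]
    exact map_pow (RingHom.mapMatrix (algebraMap ℝ ℂ)) _ _
  have hκ : 0 ≤ κ := (specNorm_nonneg K).trans hK
  calc specNorm (((A - B * K) ^ i).map (algebraMap ℝ ℂ))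
      ≤ specNorm Q * specNorm (Matrix.diagonal l) ^ i * specNorm Q⁻¹ := by
        rw [pow_eq]
        refine (specNorm_mul_le _ _).trans ?_
        gcongr
        · exact specNorm_nonneg _
        refine (specNorm_mul_le _ _).trans ?_
        gcongr
        · exact specNorm_nonneg _
        exact specNorm_pow_le _ _
    _ ≤ κ * (1 - γ) ^ i * κ := by
        have diagonal_nonneg := specNorm_nonneg (Matrix.diagonal l)
        have : 0 ≤ 1 - γ := diagonal_nonneg.trans hl
        gcongr
        exact specNorm_nonneg _
    _ = κ ^ 2 * (1 - γ) ^ i := by ring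

lemma sum_one_sub_pow_le (hγ : 0 < γ) (hγ1 : γ ≤ 1) (n : ℕ) :
    ∑ i ∈ Finset.range n, (1 - γ) ^ i ≤ γ⁻¹ := by
  have geom_sum := mul_neg_geom_sum (1 - γ) n
  have pow_nonneg := pow_nonneg (sub_nonneg.mpr hγ1) n
  rw [sub_sub_cancel] at geom_sum
  rw [← mul_one γ⁻¹, le_inv_mul_iff₀ hγ]
  linarith

lemma one_sub_pow_horizon_le (hκ : 0 < κ) (hγ : 0 < γ) (hγ1 : γ ≤ 1) {T : ℕ} (hT : 1 ≤ T) :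
    κ ^ 2 * (1 - γ) ^ horizon κ γ T ≤ 1 / T := by
  have : (0 : ℝ) < T := by exact_mod_cast hT
  have log_le : Real.log (T * κ ^ 2) ≤ γ * horizon κ γ T :=
    (inv_mul_le_iff₀ hγ).mp (Nat.le_ceil _)
  calc κ ^ 2 * (1 - γ) ^ horizon κ γ T ≤ κ ^ 2 * Real.exp (-γ) ^ horizon κ γ T := by
        have : 0 ≤ 1 - γ := sub_nonneg.mpr hγ1
        gcongr
        exact Real.one_sub_le_exp_neg γ
    _ = κ ^ 2 * Real.exp (-(γ * horizon κ γ T)) := by rw [← Real.exp_nat_mul]; ring_nf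
    _ ≤ κ ^ 2 * Real.exp (-Real.log (T * κ ^ 2)) := by gcongr
    _ = 1 / T := by rw [Real.exp_neg, Real.exp_log (by positivity)]; field_simp

end Stability

section Response

variable {R F : Type*} [CommRing R] [AddCommGroup F] [Module R F]

/-- The contribution `∑_{i<n} L^i e_{t-1-i}` of the last `n` inputs to the state at time `t` of the
recursion `x_{t+1} = L x_t + e_t`. It is meant for `n ≤ t`: the subtraction in the index is
truncated. -/
def response (L : F →ₗ[R] F) (n t : ℕ) : (ℕ → F) →ₗ[R] F :=
  ∑ i ∈ Finset.range n, (L ^ i) ∘ₗ LinearMap.proj (t - 1 - i)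

lemma response_apply (L : F →ₗ[R] F) (n t : ℕ) (e : ℕ → F) :
    response L n t e = ∑ i ∈ Finset.range n, (L ^ i) (e (t - 1 - i)) := by
  simp [response]

lemma linear_recursion_unroll {L : F →ₗ[R] F} {x e : ℕ → F}
    (h : ∀ t, 1 ≤ t → x (t + 1) = L (x t) + e t) {s : ℕ} (hs : 1 ≤ s) (n : ℕ) :
    x (s + n) = (L ^ n) (x s) + response L n (s + n) e := by
  induction n with
  | zero => simp [response_apply]
  | succ n ih =>
    rw [← add_assoc, h _ (by omega), ih, response_apply, response_apply, Finset.sum_range_succ',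
      map_add, map_sum, pow_succ', add_assoc]
    congr 2
    refine Finset.sum_congr rfl fun i _ => ?_
    rw [pow_succ', Module.End.mul_apply]
    congr 3
    omega

end Response

section NormResponse

variable {F : Type*} [NormedAddCommGroup F] [NormedSpace ℝ F] {L : F →ₗ[ℝ] F} {C γ Z : ℝ}

lemma norm_response_le (hC : 0 ≤ C) (hγ : 0 < γ) (hγ1 : γ ≤ 1) (hZ : 0 ≤ Z)
    (hL : ∀ (i : ℕ) (z : F), ‖(L ^ i) z‖ ≤ C * (1 - γ) ^ i * ‖z‖) {n t : ℕ} {e : ℕ → F}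
    (he : ∀ i < n, ‖e (t - 1 - i)‖ ≤ Z) : ‖response L n t e‖ ≤ C * γ⁻¹ * Z := by
  rw [response_apply]
  calc _ ≤ ∑ i ∈ Finset.range n, C * (1 - γ) ^ i * Z := by
        refine norm_sum_le_of_le _ fun i hi => (hL i _).trans ?_
        have : 0 ≤ 1 - γ := sub_nonneg.mpr hγ1
        have := he i (Finset.mem_range.mp hi)
        gcongr
    _ = C * (∑ i ∈ Finset.range n, (1 - γ) ^ i) * Z := by rw [Finset.mul_sum, Finset.sum_mul]
    _ ≤ _ := by
        gcongr
        exact sum_one_sub_pow_le hγ hγ1 n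

lemma norm_linear_recursion_le (hC : 0 ≤ C) (hγ : 0 < γ) (hγ1 : γ ≤ 1) (hZ : 0 ≤ Z)
    (hL : ∀ (i : ℕ) (z : F), ‖(L ^ i) z‖ ≤ C * (1 - γ) ^ i * ‖z‖) {x e : ℕ → F}
    (h : ∀ t, 1 ≤ t → x (t + 1) = L (x t) + e t) (hx : x 1 = 0) {t : ℕ} (ht : 1 ≤ t)
    (he : ∀ s, 1 ≤ s → s < t → ‖e s‖ ≤ Z) : ‖x t‖ ≤ C * γ⁻¹ * Z := by
  obtain ⟨n, rfl⟩ := Nat.exists_eq_add_of_le ht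
  rw [linear_recursion_unroll h le_rfl, hx, map_zero, zero_add]
  exact norm_response_le hC hγ hγ1 hZ hL fun i _ => he _ (by omega) (by omega)

end NormResponse

section Blocks

variable {H du dx : ℕ}

/-- The block `M^[i]` as a linear function of the parameters. -/
def blkₗ (i : ℕ) : Params H du dx →ₗ[ℝ] Matrix (Fin du) (Fin dx) ℝ where
  toFun M := blk M i
  map_add' M N := by
    unfold blk
    split_ifs
    · rfl
    · exact (add_zero 0).symm
  map_smul' c M := by
    unfold blk
    split_ifs
    · rfl
    · exact (smul_zero c).symm

lemma norm_sq_eq_sum_blk (M : Params H du dx) :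
    ‖M‖ ^ 2 = ∑ k ∈ Finset.range H, ∑ a, ∑ b, ‖blk M k a b‖ ^ 2 := by
  rw [EuclideanSpace.norm_sq_eq, Fintype.sum_prod_type, Finset.sum_range]
  refine Finset.sum_congr rfl fun k _ => ?_
  rw [Fintype.sum_prod_type]
  simp [blk]

lemma specNorm_blk_le_norm (M : Params H du dx) (i : ℕ) : specNorm (blk M i) ≤ ‖M‖ := by
  refine (specNorm_le_frobenius _).trans (Real.sqrt_le_iff.mpr ⟨norm_nonneg _, ?_⟩)
  by_cases hi : i < H
  · rw [norm_sq_eq_sum_blk]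
    exact Finset.single_le_sum (f := fun k => ∑ a, ∑ b, ‖blk M k a b‖ ^ 2)
      (fun k _ => by positivity) (Finset.mem_range.mpr hi)
  · simp [blk, hi]

lemma convex_feasible (κB κ γ : ℝ) : Convex ℝ (feasible H du dx κB κ γ) := by
  intro M hM N hN a b ha hb hab i hi
  set ρ := max (κ ^ 3 * κB * (1 - γ) ^ (i + 1)) (2 * κ ^ 3 * (1 - γ) ^ i)
  have blk_eq : blk (a • M + b • N) i = a • blk M i + b • blk N i :=
    ((blkₗ i).map_add _ _).trans (congrArg₂ _ ((blkₗ i).map_smul a M) ((blkₗ i).map_smul b N))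
  calc specNorm (blk (a • M + b • N) i)
      ≤ a * specNorm (blk M i) + b * specNorm (blk N i) := by
        rw [blk_eq]
        refine (specNorm_add_le _ _).trans_eq ?_
        rw [specNorm_smul, specNorm_smul, Real.norm_of_nonneg ha, Real.norm_of_nonneg hb]
    _ ≤ a * ρ + b * ρ := by gcongr <;> [exact hM i hi; exact hN i hi]
    _ = ρ := by rw [← add_mul, hab, one_mul]

/-- The feedforward part `∑_{k<H} M^[k] e_{s-1-k}` of the disturbance-action policy at time `s`, as
a linear function of `M`. It is meant for `H ≤ s`: the subtraction in the index is truncated. -/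
def feedforward (e : ℕ → EuclideanSpace ℝ (Fin dx)) (s : ℕ) :
    Params H du dx →ₗ[ℝ] EuclideanSpace ℝ (Fin du) :=
  ∑ k ∈ Finset.range H,
    Matrix.toEuclideanLin.toLinearMap.flip (e (s - 1 - k)) ∘ₗ blkₗ k

lemma feedforward_apply (e : ℕ → EuclideanSpace ℝ (Fin dx)) (s : ℕ) (M : Params H du dx) :
    feedforward e s M =
      ∑ k ∈ Finset.range H, (blk M k).toEuclideanLin (e (s - 1 - k)) := by
  rw [feedforward, LinearMap.sum_apply]
  rfl

lemma norm_feedforward_le {W : ℝ} {e : ℕ → EuclideanSpace ℝ (Fin dx)} (he : ∀ s, ‖e s‖ ≤ W)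
    (s : ℕ) (M : Params H du dx) : ‖feedforward e s M‖ ≤ W * H * ‖M‖ := by
  rw [feedforward_apply]
  calc _ ≤ ∑ _k ∈ Finset.range H, ‖M‖ * W := by
        refine norm_sum_le_of_le _ fun k _ =>
          (norm_toEuclideanLin_le (specNorm_blk_le_norm M k) _).trans ?_
        gcongr
        exact he _
    _ = W * H * ‖M‖ := by rw [Finset.sum_const, Finset.card_range, nsmul_eq_mul]; ring

end Blocks

section Gains

variable {R : Type*} [CommSemiring R]

/-- The feedforward term of a feasible policy is at most `W * feedforwardGain γ⁻¹ κB κ`. The gains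
are defined over semirings, so that they make sense for polynomial variables as well. -/
def feedforwardGain (g κB κ : R) : R := κ ^ 3 * (κB + 2) * g

/-- All states and actions are at most `W * stateGain γ⁻¹ κB κ`. -/
def stateGain (g κB κ : R) : R :=
  κ ^ 3 * g * (1 + κB * feedforwardGain g κB κ) + feedforwardGain g κB κ

/-- The sensitivity of state and action to perturbations of the feedforward term. -/
def lipGain (g κB κ : R) : R := (1 + κ) * (κ ^ 2 * g * κB) + 1

end Gains

section Dynamics

variable {H dx du : ℕ} {A : Matrix (Fin dx) (Fin dx) ℝ} {B : Matrix (Fin dx) (Fin du) ℝ}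
  {𝕂 : Matrix (Fin du) (Fin dx) ℝ} {κB κ γ W δ : ℝ}

/-- The assumptions on the dynamics `(A, B)` and on the stabilizing policy `𝕂`. -/
structure StableSystem (A : Matrix (Fin dx) (Fin dx) ℝ) (B : Matrix (Fin dx) (Fin du) ℝ)
    (𝕂 : Matrix (Fin du) (Fin dx) ℝ) (κB κ γ : ℝ) : Prop where
  one_le : 1 ≤ κ
  pos : 0 < γ
  le_one : γ ≤ 1
  specNorm_le : specNorm B ≤ κB
  stable : PowerStable A B κ γ 𝕂

namespace StableSystem

lemma kappa_pos (S : StableSystem A B 𝕂 κB κ γ) : 0 < κ := zero_lt_one.trans_le S.one_le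

lemma kappaB_nonneg (S : StableSystem A B 𝕂 κB κ γ) : 0 ≤ κB :=
  (specNorm_nonneg B).trans S.specNorm_le

lemma inv_pos (S : StableSystem A B 𝕂 κB κ γ) : 0 < γ⁻¹ := _root_.inv_pos.mpr S.pos

lemma one_sub_nonneg (S : StableSystem A B 𝕂 κB κ γ) : 0 ≤ 1 - γ := sub_nonneg.mpr S.le_one

lemma feedforwardGain_nonneg (S : StableSystem A B 𝕂 κB κ γ) :
    0 ≤ feedforwardGain γ⁻¹ κB κ := by
  have := S.kappa_pos
  have := S.kappaB_nonneg
  have := S.inv_pos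
  unfold feedforwardGain
  positivity

lemma stateGain_pos (S : StableSystem A B 𝕂 κB κ γ) : 0 < stateGain γ⁻¹ κB κ := by
  have := S.kappa_pos
  have := S.kappaB_nonneg
  have := S.inv_pos
  have := S.feedforwardGain_nonneg
  unfold stateGain
  positivity

lemma lipGain_pos (S : StableSystem A B 𝕂 κB κ γ) : 0 < lipGain γ⁻¹ κB κ := by
  have := S.kappa_pos
  have := S.kappaB_nonneg
  have := S.inv_pos
  unfold lipGain
  positivity

lemma specNorm_blk_le (S : StableSystem A B 𝕂 κB κ γ) {M : Params H du dx}
    (hM : M ∈ feasible H du dx κB κ γ) {i : ℕ} (hi : i < H) :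
    specNorm (blk M i) ≤ κ ^ 3 * (κB + 2) * (1 - γ) ^ i := by
  have hκ := S.kappa_pos
  have hκB := S.kappaB_nonneg
  have hγ := S.one_sub_nonneg
  have pow_le : (1 - γ) ^ (i + 1) ≤ (1 - γ) ^ i :=
    pow_le_pow_of_le_one hγ (sub_le_self 1 S.pos.le) i.le_succ
  refine (hM i hi).trans (max_le ?_ ?_)
  · exact mul_le_mul (by gcongr; linarith) pow_le (by positivity) (by positivity)
  · rw [mul_comm 2]
    gcongr
    linarith

lemma norm_feedforward_le_of_feasible (S : StableSystem A B 𝕂 κB κ γ) {M : Params H du dx}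
    (hM : M ∈ feasible H du dx κB κ γ) {e : ℕ → EuclideanSpace ℝ (Fin dx)}
    (he : ∀ s, ‖e s‖ ≤ W) (t : ℕ) : ‖feedforward e t M‖ ≤ W * feedforwardGain γ⁻¹ κB κ := by
  have := S.kappa_pos
  have := S.kappaB_nonneg
  have : 0 ≤ W := (norm_nonneg _).trans (he 0)
  rw [feedforward_apply]
  calc _ ≤ ∑ k ∈ Finset.range H, κ ^ 3 * (κB + 2) * (1 - γ) ^ k * W := by
        refine norm_sum_le_of_le _ fun k hk =>
          (norm_toEuclideanLin_le (S.specNorm_blk_le hM (Finset.mem_range.mp hk)) _).trans ?_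
        have := S.one_sub_nonneg
        gcongr
        exact he _
    _ = κ ^ 3 * (κB + 2) * W * ∑ k ∈ Finset.range H, (1 - γ) ^ k := by
        rw [Finset.mul_sum]
        exact Finset.sum_congr rfl fun k _ => by ring
    _ ≤ κ ^ 3 * (κB + 2) * W * γ⁻¹ := by
        gcongr
        exact sum_one_sub_pow_le S.pos S.le_one H
    _ = W * feedforwardGain γ⁻¹ κB κ := by unfold feedforwardGain; ring

lemma norm_input_le (S : StableSystem A B 𝕂 κB κ γ) {z : EuclideanSpace ℝ (Fin dx)}
    {m : EuclideanSpace ℝ (Fin du)} (hz : ‖z‖ ≤ W) (hm : ‖m‖ ≤ W * feedforwardGain γ⁻¹ κB κ) :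
    ‖z + B.toEuclideanLin m‖ ≤ W * (1 + κB * feedforwardGain γ⁻¹ κB κ) :=
  calc ‖z + B.toEuclideanLin m‖ ≤ W + κB * (W * feedforwardGain γ⁻¹ κB κ) :=
        norm_add_le_of_le hz ((norm_toEuclideanLin_le S.specNorm_le m).trans
          (mul_le_mul_of_nonneg_left hm S.kappaB_nonneg))
    _ = W * (1 + κB * feedforwardGain γ⁻¹ κB κ) := by ring

lemma norm_state_le_and_norm_action_le (S : StableSystem A B 𝕂 κB κ γ) (hW : 0 ≤ W)
    {x : EuclideanSpace ℝ (Fin dx)} {m : EuclideanSpace ℝ (Fin du)}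
    (hx : ‖x‖ ≤ κ ^ 2 * γ⁻¹ * (W * (1 + κB * feedforwardGain γ⁻¹ κB κ)))
    (hm : ‖m‖ ≤ W * feedforwardGain γ⁻¹ κB κ) :
    ‖x‖ ≤ W * stateGain γ⁻¹ κB κ ∧ ‖-𝕂.toEuclideanLin x + m‖ ≤ W * stateGain γ⁻¹ κB κ := by
  have stateGain_eq : κ * (κ ^ 2 * γ⁻¹ * (W * (1 + κB * feedforwardGain γ⁻¹ κB κ))) +
      W * feedforwardGain γ⁻¹ κB κ = W * stateGain γ⁻¹ κB κ := by unfold stateGain; ring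
  have norm_mul_le := mul_le_mul_of_nonneg_left hx S.kappa_pos.le
  constructor
  · have := le_mul_of_one_le_left (norm_nonneg x) S.one_le
    have := mul_nonneg hW S.feedforwardGain_nonneg
    linarith
  · rw [← stateGain_eq]
    refine norm_add_le_of_le ?_ hm
    rw [norm_neg]
    exact (norm_toEuclideanLin_le S.stable.specNorm_gain_le x).trans norm_mul_le

lemma norm_response_sub_le (S : StableSystem A B 𝕂 κB κ γ) {n t : ℕ}
    {m m' : ℕ → EuclideanSpace ℝ (Fin du)} (hδ : 0 ≤ δ) (e : ℕ → EuclideanSpace ℝ (Fin dx))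
    (hm : ∀ i < n, ‖m (t - 1 - i) - m' (t - 1 - i)‖ ≤ δ) :
    ‖response (closedLoop A B 𝕂) n t (fun s => e s + B.toEuclideanLin (m s)) -
      response (closedLoop A B 𝕂) n t (fun s => e s + B.toEuclideanLin (m' s))‖ ≤
      κ ^ 2 * γ⁻¹ * (κB * δ) := by
  have := S.kappaB_nonneg
  rw [← map_sub]
  refine norm_response_le (sq_nonneg κ) S.pos S.le_one (by positivity) S.stable.norm_pow_le
    fun i hi => ?_
  rw [Pi.sub_apply, add_sub_add_left_eq_sub, ← map_sub]
  exact (norm_toEuclideanLin_le S.specNorm_le _).trans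
    (mul_le_mul_of_nonneg_left (hm i hi) S.kappaB_nonneg)

lemma norm_state_sub_add_norm_action_sub_le (S : StableSystem A B 𝕂 κB κ γ) {D : ℝ}
    {x y : EuclideanSpace ℝ (Fin dx)} {m n : EuclideanSpace ℝ (Fin du)}
    (hxy : ‖x - y‖ ≤ D + κ ^ 2 * γ⁻¹ * (κB * δ)) (hmn : ‖m - n‖ ≤ δ) :
    ‖x - y‖ + ‖(-𝕂.toEuclideanLin x + m) - (-𝕂.toEuclideanLin y + n)‖ ≤
      (1 + κ) * D + lipGain γ⁻¹ κB κ * δ := by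
  have action_sub_eq : (-𝕂.toEuclideanLin x + m) - (-𝕂.toEuclideanLin y + n) =
      -𝕂.toEuclideanLin (x - y) + (m - n) := by
    rw [map_sub]
    abel
  have norm_action_sub_le : ‖-𝕂.toEuclideanLin (x - y) + (m - n)‖ ≤ κ * ‖x - y‖ + δ := by
    refine norm_add_le_of_le ?_ hmn
    rw [norm_neg]
    exact norm_toEuclideanLin_le S.stable.specNorm_gain_le _
  rw [action_sub_eq]
  have := mul_le_mul_of_nonneg_left hxy S.kappa_pos.le
  unfold lipGain
  linarith

end StableSystem

end Dynamics

section Truncation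

variable {H dx du : ℕ} {A : Matrix (Fin dx) (Fin dx) ℝ} {B : Matrix (Fin dx) (Fin du) ℝ}
  {𝕂 : Matrix (Fin du) (Fin dx) ℝ} {κB κ γ W δ : ℝ}

variable (A B 𝕂) in
/-- The surrogate state at time `t`, as a function of a noise sequence indexed by time: the response
to the last `H + 1` inputs of the disturbance-action policy with constant parameters `M`. -/
def truncState (M : Params H du dx) (e : ℕ → EuclideanSpace ℝ (Fin dx)) (t : ℕ) :
    EuclideanSpace ℝ (Fin dx) :=
  response (closedLoop A B 𝕂) (H + 1) t fun s => e s + B.toEuclideanLin (feedforward e s M)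

variable (A B 𝕂) in
/-- The surrogate action at time `t`, as a function of a noise sequence indexed by time. -/
def truncAction (M : Params H du dx) (e : ℕ → EuclideanSpace ℝ (Fin dx)) (t : ℕ) :
    EuclideanSpace ℝ (Fin du) :=
  -𝕂.toEuclideanLin (truncState A B 𝕂 M e t) + feedforward e t M

lemma sum_range_ite_window {F : Type*} [AddCommMonoid F] (f : ℕ → F) {a n N : ℕ}
    (h : a + n ≤ N) :
    ∑ i ∈ Finset.range N, (if a ≤ i ∧ i < a + n then f i else 0) =
      ∑ k ∈ Finset.range n, f (a + k) := by
  have filter_eq : {i ∈ Finset.range N | a ≤ i ∧ i < a + n} = Finset.Ico a (a + n) := by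
    ext i
    simp only [Finset.mem_filter, Finset.mem_range, Finset.mem_Ico]
    omega
  rw [← Finset.sum_filter, filter_eq, Finset.sum_Ico_eq_sum_range, Nat.add_sub_cancel_left]

lemma transfer_apply (M : ℕ → Params H du dx) (i : ℕ) (z : EuclideanSpace ℝ (Fin dx)) :
    (transfer A B 𝕂 M i).toEuclideanLin z =
      (if 0 ≤ i ∧ i < 0 + (H + 1) then (closedLoop A B 𝕂 ^ i) z else 0) +
      ∑ j ∈ Finset.range (H + 1), if j + 1 ≤ i ∧ i < j + 1 + H then
        (closedLoop A B 𝕂 ^ j) (B.toEuclideanLin ((blk (M (H - j)) (i - j - 1)).toEuclideanLin z))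
      else 0 := by
  rw [transfer, map_add, LinearMap.add_apply, map_sum, LinearMap.sum_apply]
  congr 1
  · simp only [zero_le, true_and, zero_add, Nat.lt_succ_iff]
    split_ifs
    · rw [Matrix.toLpLin_pow]
    · simp
  · refine Finset.sum_congr rfl fun j _ => ?_
    simp only [show i < j + 1 + H ↔ i ≤ j + H by omega]
    split_ifs
    · rw [toEuclideanLin_mul_apply, toEuclideanLin_mul_apply, Matrix.toLpLin_pow]
    · simp

lemma surrogateState_eq (M : Params H du dx) (e : ℕ → EuclideanSpace ℝ (Fin dx)) {t : ℕ}
    (ht : 2 * H + 1 ≤ t) :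
    surrogateState A B 𝕂 (fun _ => M) (fun i => e (t - 1 - 2 * H + i)) =
      truncState A B 𝕂 M e t :=
  calc _ = ∑ i ∈ Finset.range (2 * H + 1),
        (transfer A B 𝕂 (fun _ => M) i).toEuclideanLin (e (t - 1 - i)) := by
        rw [surrogateState, Finset.sum_range]
        refine Finset.sum_congr rfl fun i _ => ?_
        rw [Fin.val_rev, show t - 1 - 2 * H + (2 * H + 1 - (i + 1)) = t - 1 - i by omega]
    _ = ∑ j ∈ Finset.range (H + 1), (closedLoop A B 𝕂 ^ j) (e (t - 1 - j)) +
        ∑ j ∈ Finset.range (H + 1), ∑ k ∈ Finset.range H, (closedLoop A B 𝕂 ^ j)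
          (B.toEuclideanLin ((blk M k).toEuclideanLin (e (t - 1 - j - 1 - k)))) := by
        simp only [transfer_apply, Finset.sum_add_distrib]
        rw [sum_range_ite_window _ (by omega), Finset.sum_comm]
        simp only [zero_add]
        congr 1
        refine Finset.sum_congr rfl fun j hj => ?_
        rw [sum_range_ite_window _ (by have := Finset.mem_range.mp hj; omega)]
        refine Finset.sum_congr rfl fun k _ => ?_
        rw [show j + 1 + k - j - 1 = k by omega,
          show t - 1 - (j + 1 + k) = t - 1 - j - 1 - k by omega]
    _ = truncState A B 𝕂 M e t := by
        simp only [truncState, response_apply, feedforward_apply, map_add, map_sum,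
          Finset.sum_add_distrib]

lemma surrogateAction_eq (M : Params H du dx) (e : ℕ → EuclideanSpace ℝ (Fin dx)) {t : ℕ}
    (ht : 2 * H + 1 ≤ t) :
    surrogateAction A B 𝕂 (fun _ => M) (fun i => e (t - 1 - 2 * H + i)) =
      truncAction A B 𝕂 M e t := by
  rw [surrogateAction, surrogateState_eq M e ht, truncAction, feedforward_apply, Finset.sum_range]
  congr 1
  refine Finset.sum_congr rfl fun i _ => ?_
  rw [Fin.val_rev, show t - 1 - 2 * H + (2 * H + 1 - (i + 1)) = t - 1 - i by omega]

namespace StableSystem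

lemma norm_truncState_le_and_norm_truncAction_le (S : StableSystem A B 𝕂 κB κ γ)
    {M : Params H du dx} (hM : M ∈ feasible H du dx κB κ γ)
    {e : ℕ → EuclideanSpace ℝ (Fin dx)} (he : ∀ s, ‖e s‖ ≤ W) (t : ℕ) :
    ‖truncState A B 𝕂 M e t‖ ≤ W * stateGain γ⁻¹ κB κ ∧
      ‖truncAction A B 𝕂 M e t‖ ≤ W * stateGain γ⁻¹ κB κ := by
  have hW : 0 ≤ W := (norm_nonneg _).trans (he 0)
  have := S.kappaB_nonneg
  have := S.feedforwardGain_nonneg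
  have hm := S.norm_feedforward_le_of_feasible hM he
  exact S.norm_state_le_and_norm_action_le hW (norm_response_le (sq_nonneg κ) S.pos S.le_one
    (by positivity) S.stable.norm_pow_le fun i _ => S.norm_input_le (he _) (hm _)) (hm t)

lemma norm_trunc_sub_le (S : StableSystem A B 𝕂 κB κ γ) (M N : Params H du dx)
    {e : ℕ → EuclideanSpace ℝ (Fin dx)} (he : ∀ s, ‖e s‖ ≤ W) (t : ℕ) :
    ‖truncState A B 𝕂 M e t - truncState A B 𝕂 N e t‖ +
      ‖truncAction A B 𝕂 M e t - truncAction A B 𝕂 N e t‖ ≤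
        lipGain γ⁻¹ κB κ * (W * H * ‖M - N‖) := by
  have : 0 ≤ W := (norm_nonneg _).trans (he 0)
  have hm s : ‖feedforward e s M - feedforward e s N‖ ≤ W * H * ‖M - N‖ := by
    rw [← map_sub]
    exact norm_feedforward_le he s _
  refine (S.norm_state_sub_add_norm_action_sub_le (D := 0) ?_ (hm t)).trans_eq (by ring)
  rw [zero_add]
  exact S.norm_response_sub_le (by positivity) e fun i _ => hm _

lemma norm_sub_trunc_le (S : StableSystem A B 𝕂 κB κ γ) (M : Params H du dx)
    {e x : ℕ → EuclideanSpace ℝ (Fin dx)} {m : ℕ → EuclideanSpace ℝ (Fin du)} {X : ℝ}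
    (hδ : 0 ≤ δ)
    (h : ∀ t, 1 ≤ t → x (t + 1) = closedLoop A B 𝕂 (x t) + (e t + B.toEuclideanLin (m t)))
    {t : ℕ} (ht : H + 2 ≤ t) (hX : ‖x (t - H - 1)‖ ≤ X)
    (hm : ∀ s, t - 1 - H ≤ s → s ≤ t → ‖m s - feedforward e s M‖ ≤ δ) :
    ‖x t - truncState A B 𝕂 M e t‖ +
      ‖(-𝕂.toEuclideanLin (x t) + m t) - truncAction A B 𝕂 M e t‖ ≤
        (1 + κ) * (κ ^ 2 * (1 - γ) ^ H * X) + lipGain γ⁻¹ κB κ * δ := by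
  have unroll := linear_recursion_unroll h (s := t - H - 1) (by omega) (H + 1)
  rw [show t - H - 1 + (H + 1) = t by omega] at unroll
  refine S.norm_state_sub_add_norm_action_sub_le ?_ (hm t (by omega) le_rfl)
  nth_rw 1 [unroll]
  rw [truncState, add_sub_assoc]
  refine norm_add_le_of_le ?_
    (S.norm_response_sub_le hδ e fun i hi => hm _ (by omega) (by omega))
  calc _ ≤ κ ^ 2 * (1 - γ) ^ (H + 1) * ‖x (t - H - 1)‖ := S.stable.norm_pow_le _ _
    _ ≤ κ ^ 2 * (1 - γ) ^ H * X := by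
      have := S.one_sub_nonneg
      have : (1 - γ) ^ (H + 1) ≤ (1 - γ) ^ H :=
        pow_le_pow_of_le_one this (sub_le_self 1 S.pos.le) H.le_succ
      gcongr

end StableSystem

end Truncation

section Cost

variable {dx du : ℕ} {α G : ℝ} {c : EuclideanSpace ℝ (Fin dx) → EuclideanSpace ℝ (Fin du) → ℝ}

lemma norm_image_sub_le_of_norm_gradient_le {F : Type*} [NormedAddCommGroup F]
    [InnerProductSpace ℝ F] [CompleteSpace F] {f : F → ℝ} {C D : ℝ} (hf : Differentiable ℝ f)
    (hC : ∀ x, ‖x‖ ≤ D → ‖gradient f x‖ ≤ C) {x y : F} (hx : ‖x‖ ≤ D) (hy : ‖y‖ ≤ D) :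
    ‖f x - f y‖ ≤ C * ‖x - y‖ := by
  refine Convex.norm_image_sub_le_of_norm_fderiv_le (𝕜 := ℝ) (s := Metric.closedBall 0 D)
    (fun z _ => hf z) (fun z hz => ?_) (convex_closedBall 0 D) (mem_closedBall_zero_iff.mpr hy)
    (mem_closedBall_zero_iff.mpr hx)
  simpa [gradient] using hC z (mem_closedBall_zero_iff.mp hz)

namespace CostClass

lemma continuous (h : CostClass α G c) : Continuous (fun z : _ × _ => c z.1 z.2) :=
  h.diff.continuous

lemma G_nonneg (h : CostClass α G c) : 0 ≤ G := by
  simpa using (norm_nonneg _).trans (h.grad_x 1 0 0 (by simp) (by simp))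

lemma abs_sub_le (h : CostClass α G c) {D : ℝ} {x x' : EuclideanSpace ℝ (Fin dx)}
    {u u' : EuclideanSpace ℝ (Fin du)} (hx : ‖x‖ ≤ D) (hx' : ‖x'‖ ≤ D) (hu : ‖u‖ ≤ D)
    (hu' : ‖u'‖ ≤ D) : |c x u - c x' u'| ≤ G * D * (‖x - x'‖ + ‖u - u'‖) := by
  have state_step : ‖c x u - c x' u‖ ≤ G * D * ‖x - x'‖ :=
    norm_image_sub_le_of_norm_gradient_le (f := fun y => c y u)
      (h.diff.comp (differentiable_id.prodMk (differentiable_const u)))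
      (fun y hy => h.grad_x D y u hy hu) hx hx'
  have action_step : ‖c x' u - c x' u'‖ ≤ G * D * ‖u - u'‖ :=
    norm_image_sub_le_of_norm_gradient_le (f := fun y => c x' y)
      (h.diff.comp ((differentiable_const x').prodMk differentiable_id))
      (fun y hy => h.grad_u D x' y hx' hy) hu hu'
  rw [← Real.norm_eq_abs, mul_add]
  exact (norm_sub_le_norm_sub_add_norm_sub _ _ _).trans (add_le_add state_step action_step)

lemma abs_sub_zero_le (h : CostClass α G c) {D : ℝ} {x : EuclideanSpace ℝ (Fin dx)}
    {u : EuclideanSpace ℝ (Fin du)} (hx : ‖x‖ ≤ D) (hu : ‖u‖ ≤ D) :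
    |c x u - c 0 0| ≤ 2 * G * D ^ 2 := by
  have hD : 0 ≤ D := (norm_nonneg x).trans hx
  have := h.G_nonneg
  calc |c x u - c 0 0| ≤ G * D * (‖x‖ + ‖u‖) := by
        simpa using h.abs_sub_le (D := D) (x' := 0) (u' := 0) hx (by simpa) hu (by simpa)
    _ ≤ G * D * (D + D) := by gcongr
    _ = 2 * G * D ^ 2 := by ring

lemma strong_convexity (h : CostClass α G c) (x x' : EuclideanSpace ℝ (Fin dx))
    (u u' : EuclideanSpace ℝ (Fin du)) {a b : ℝ} (ha : 0 ≤ a) (hb : 0 ≤ b) (hab : a + b = 1) :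
    c (a • x + b • x') (a • u + b • u') ≤ a * c x u + b * c x' u' -
      a * b * (α / 2 * (‖x - x'‖ ^ 2 + ‖u - u'‖ ^ 2)) := by
  have := h.strong.2 (Set.mem_univ (WithLp.toLp 2 (x, u))) (Set.mem_univ (WithLp.toLp 2 (x', u')))
    ha hb hab
  simpa [WithLp.prod_norm_sq_eq_of_L2] using this

lemma alpha_le (h : CostClass α G c) (hdx : 0 < dx) : α ≤ 6 * G := by
  set e : EuclideanSpace ℝ (Fin dx) := EuclideanSpace.single ⟨0, hdx⟩ 1
  have norm_e : ‖e‖ = 1 := by simp [e]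
  have norm_half : ‖(1 / 2 : ℝ) • e‖ = 1 / 2 := by rw [norm_smul, norm_e]; norm_num
  have midpoint : c ((1 / 2 : ℝ) • e) 0 ≤ 1 / 2 * c 0 0 + 1 / 2 * c e 0 - 1 / 4 * (α / 2) := by
    have := h.strong_convexity 0 e 0 0 (a := 1 / 2) (b := 1 / 2) (by norm_num) (by norm_num)
      (by norm_num)
    norm_num [norm_e] at this ⊢
    exact this
  have half_growth : |c ((1 / 2 : ℝ) • e) 0 - c 0 0| ≤ G * (1 / 2) * (1 / 2) := by
    simpa [norm_smul, norm_e] using h.abs_sub_le (D := 1 / 2) (x := (1 / 2 : ℝ) • e) (x' := 0)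
      (u := 0) (u' := 0) norm_half.le (by simp) (by simp) (by simp)
  have growth : |c e 0 - c 0 0| ≤ G := by
    simpa [norm_e] using h.abs_sub_le (D := 1) (x := e) (x' := 0) (u := 0) (u' := 0) norm_e.le
      (by simp) (by simp) (by simp)
  linarith [abs_le.mp half_growth, abs_le.mp growth]

end CostClass

end Cost

section Trajectories

variable {H dx du : ℕ} {A : Matrix (Fin dx) (Fin dx) ℝ} {B : Matrix (Fin dx) (Fin du) ℝ}
  {𝕂 K : Matrix (Fin du) (Fin dx) ℝ} {κB κ γ W : ℝ} {w : ℕ → EuclideanSpace ℝ (Fin dx)}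

lemma states_succ_of_action_eq {π : ℕ → EuclideanSpace ℝ (Fin dx) → EuclideanSpace ℝ (Fin du)}
    {t : ℕ} (ht : 1 ≤ t) {m : EuclideanSpace ℝ (Fin du)}
    (h : π t (states A B π w t) = -𝕂.toEuclideanLin (states A B π w t) + m) :
    states A B π w (t + 1) =
      closedLoop A B 𝕂 (states A B π w t) + (w t + B.toEuclideanLin m) := by
  have states_succ : states A B π w (t + 1) = A.toEuclideanLin (states A B π w t) +
      B.toEuclideanLin (π t (states A B π w t)) + w t := by
    obtain ⟨s, rfl⟩ := Nat.exists_eq_add_of_le' ht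
    rfl
  rw [states_succ, h, closedLoop, map_sub, LinearMap.sub_apply, toEuclideanLin_mul_apply,
    map_add, map_neg]
  abel

-- Index `0` collects all the truncated subtractions, so the noise before the start is `w 0 := 0`.
lemma dapPolicy_eq (M : ℕ → Params H du dx) (w : ℕ → EuclideanSpace ℝ (Fin dx)) (t : ℕ)
    (x : EuclideanSpace ℝ (Fin dx)) :
    dapPolicy 𝕂 M w t x =
      -𝕂.toEuclideanLin x + feedforward (Function.update w 0 0) t (M t) := by
  rw [dapPolicy, feedforward_apply, show Finset.Icc 1 H = Finset.Ico 1 (H + 1) from rfl,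
    Finset.sum_Ico_eq_sum_range, Nat.add_sub_cancel]
  congr 1
  refine Finset.sum_congr rfl fun k _ => ?_
  rw [Nat.add_sub_cancel_left, Nat.sub_sub]
  split_ifs with h
  · rw [Function.update_of_ne (by omega)]
  · rw [show t - (1 + k) = 0 by omega, Function.update_self, map_zero]

lemma feedforward_update_zero (w : ℕ → EuclideanSpace ℝ (Fin dx)) {s : ℕ} (hs : H < s) :
    (feedforward (Function.update w 0 0) s : Params H du dx →ₗ[ℝ] _) = feedforward w s := by
  ext1 M
  rw [feedforward_apply, feedforward_apply]
  refine Finset.sum_congr rfl fun k hk => ?_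
  rw [Function.update_of_ne (by have := Finset.mem_range.mp hk; omega)]

lemma norm_update_zero_le (hw : ∀ s, ‖w s‖ ≤ W) (s : ℕ) : ‖Function.update w 0 0 s‖ ≤ W := by
  rcases eq_or_ne s 0 with rfl | hs
  · simpa using (norm_nonneg _).trans (hw 0)
  · simpa [hs] using hw s

lemma states_dapPolicy_succ (M : ℕ → Params H du dx) {t : ℕ} (ht : 1 ≤ t) :
    states A B (dapPolicy 𝕂 M w) w (t + 1) =
      closedLoop A B 𝕂 (states A B (dapPolicy 𝕂 M w) w t) +
        (w t + B.toEuclideanLin (feedforward (Function.update w 0 0) t (M t))) :=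
  states_succ_of_action_eq ht (dapPolicy_eq M w t _)

lemma linearPolicy_eq (𝕂 K : Matrix (Fin du) (Fin dx) ℝ) (t : ℕ)
    (x : EuclideanSpace ℝ (Fin dx)) :
    linearPolicy K t x = -𝕂.toEuclideanLin x + (𝕂 - K).toEuclideanLin x := by
  rw [linearPolicy, map_sub, LinearMap.sub_apply]
  abel

lemma states_linearPolicy_succ {t : ℕ} (ht : 1 ≤ t) :
    states A B (linearPolicy K) w (t + 1) =
      closedLoop A B K (states A B (linearPolicy K) w t) + w t := by
  simpa using states_succ_of_action_eq (A := A) (B := B) (w := w) ht (linearPolicy_eq K K t _)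

/-- The disturbance-action parameters that imitate the linear policy `u = -K x`: unrolling the
recursion for its states expresses the correction `(𝕂 - K) x_t` through past noise. -/
def imitation (A : Matrix (Fin dx) (Fin dx) ℝ) (B : Matrix (Fin dx) (Fin du) ℝ)
    (𝕂 K : Matrix (Fin du) (Fin dx) ℝ) (H : ℕ) : Params H du dx :=
  WithLp.toLp 2 fun p => ((𝕂 - K) * (A - B * K) ^ (p.1 : ℕ)) p.2.1 p.2.2

lemma blk_imitation {i : ℕ} (hi : i < H) :
    blk (imitation A B 𝕂 K H) i = (𝕂 - K) * (A - B * K) ^ i := by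
  ext
  simp [blk, hi, imitation]

lemma feedforward_imitation (s : ℕ) :
    feedforward w s (imitation A B 𝕂 K H) =
      (𝕂 - K).toEuclideanLin (response (closedLoop A B K) H s w) := by
  rw [feedforward_apply, response_apply, map_sum]
  refine Finset.sum_congr rfl fun k hk => ?_
  rw [blk_imitation (Finset.mem_range.mp hk), toEuclideanLin_mul_apply, Matrix.toLpLin_pow]

lemma PowerStable.specNorm_sub_le (h : PowerStable A B κ γ 𝕂) (hK : PowerStable A B κ γ K) :
    specNorm (𝕂 - K) ≤ 2 * κ := by
  linarith [OnlineControl.specNorm_sub_le 𝕂 K, h.specNorm_gain_le, hK.specNorm_gain_le]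

namespace StableSystem

lemma norm_states_dapPolicy_le (S : StableSystem A B 𝕂 κB κ γ) {M : ℕ → Params H du dx}
    (hw : ∀ s, ‖w s‖ ≤ W) {T : ℕ}
    (hM : ∀ t, 1 ≤ t → t ≤ T → M t ∈ feasible H du dx κB κ γ) {t : ℕ} (ht : 1 ≤ t)
    (htT : t ≤ T) :
    ‖states A B (dapPolicy 𝕂 M w) w t‖ ≤ W * stateGain γ⁻¹ κB κ ∧
      ‖dapPolicy 𝕂 M w t (states A B (dapPolicy 𝕂 M w) w t)‖ ≤ W * stateGain γ⁻¹ κB κ := by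
  have : 0 ≤ W := (norm_nonneg _).trans (hw 0)
  have := S.feedforwardGain_nonneg
  have := S.kappaB_nonneg
  have feedforward_le s (hs : 1 ≤ s) (hsT : s ≤ T) :=
    S.norm_feedforward_le_of_feasible (hM s hs hsT) (norm_update_zero_le hw) s
  rw [dapPolicy_eq]
  refine S.norm_state_le_and_norm_action_le ‹_› ?_ (feedforward_le t ht htT)
  exact norm_linear_recursion_le (sq_nonneg κ) S.pos S.le_one (by positivity)
    S.stable.norm_pow_le (fun s hs => states_dapPolicy_succ M hs) rfl ht
    fun s hs hst => S.norm_input_le (hw s) (feedforward_le s hs (by omega))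

lemma norm_states_linearPolicy_le (S : StableSystem A B K κB κ γ) (hw : ∀ s, ‖w s‖ ≤ W) {t : ℕ}
    (ht : 1 ≤ t) :
    ‖states A B (linearPolicy K) w t‖ ≤ W * stateGain γ⁻¹ κB κ ∧
      ‖linearPolicy K t (states A B (linearPolicy K) w t)‖ ≤ W * stateGain γ⁻¹ κB κ := by
  have hW : 0 ≤ W := (norm_nonneg _).trans (hw 0)
  have := S.feedforwardGain_nonneg
  have := S.kappaB_nonneg
  have norm_zero_le : ‖(0 : EuclideanSpace ℝ (Fin du))‖ ≤ W * feedforwardGain γ⁻¹ κB κ := by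
    rw [norm_zero]
    positivity
  have input_le s : ‖w s‖ ≤ W * (1 + κB * feedforwardGain γ⁻¹ κB κ) := by
    simpa using S.norm_input_le (hw s) norm_zero_le
  have state_le := norm_linear_recursion_le (sq_nonneg κ) S.pos S.le_one (by positivity)
    S.stable.norm_pow_le (fun s hs => states_linearPolicy_succ hs) rfl ht
    fun s _ _ => input_le s
  simpa [linearPolicy] using S.norm_state_le_and_norm_action_le hW state_le norm_zero_le

lemma imitation_mem_feasible (S : StableSystem A B 𝕂 κB κ γ) (hK : PowerStable A B κ γ K) :
    imitation A B 𝕂 K H ∈ feasible H du dx κB κ γ := fun i hi => by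
  have := S.kappa_pos
  refine le_max_of_le_right ?_
  rw [blk_imitation hi]
  calc _ ≤ specNorm (𝕂 - K) * specNorm ((A - B * K) ^ i) := specNorm_mul_le _ _
    _ ≤ 2 * κ * (κ ^ 2 * (1 - γ) ^ i) :=
      mul_le_mul (S.stable.specNorm_sub_le hK) (hK.specNorm_pow_le i) (specNorm_nonneg _)
        (by positivity)
    _ = _ := by ring

lemma norm_gain_sub_feedforward_imitation_le (S : StableSystem A B 𝕂 κB κ γ)
    (hK : PowerStable A B κ γ K) (hw : ∀ s, ‖w s‖ ≤ W) {s : ℕ} (hs : H < s) :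
    ‖(𝕂 - K).toEuclideanLin (states A B (linearPolicy K) w s) -
      feedforward w s (imitation A B 𝕂 K H)‖ ≤
        2 * κ * (κ ^ 2 * (1 - γ) ^ H * (W * stateGain γ⁻¹ κB κ)) := by
  have := S.kappa_pos
  have := S.one_sub_nonneg
  have unroll := linear_recursion_unroll (s := s - H)
    (fun t ht => states_linearPolicy_succ (A := A) (B := B) (K := K) (w := w) ht) (by omega) H
  rw [Nat.sub_add_cancel hs.le] at unroll
  rw [feedforward_imitation, ← map_sub, unroll, add_sub_cancel_right]
  refine (norm_toEuclideanLin_le (S.stable.specNorm_sub_le hK) _).trans ?_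
  gcongr
  refine (hK.norm_pow_le H _).trans ?_
  gcongr
  exact (norm_states_linearPolicy_le { S with stable := hK } hw (by omega)).1

lemma norm_linearPolicy_sub_trunc_le (S : StableSystem A B 𝕂 κB κ γ)
    (hK : PowerStable A B κ γ K) (hw : ∀ s, ‖w s‖ ≤ W) {t : ℕ} (ht : 2 * H + 2 ≤ t) :
    ‖states A B (linearPolicy K) w t - truncState A B 𝕂 (imitation A B 𝕂 K H) w t‖ +
      ‖linearPolicy K t (states A B (linearPolicy K) w t) -
        truncAction A B 𝕂 (imitation A B 𝕂 K H) w t‖ ≤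
      (1 + κ + 2 * κ * lipGain γ⁻¹ κB κ) *
        (κ ^ 2 * (1 - γ) ^ H * (W * stateGain γ⁻¹ κB κ)) := by
  have := S.kappa_pos
  have := S.one_sub_nonneg
  have := S.stateGain_pos
  have : 0 ≤ W := (norm_nonneg _).trans (hw 0)
  rw [linearPolicy_eq 𝕂]
  refine (S.norm_sub_trunc_le _ (δ := 2 * κ * (κ ^ 2 * (1 - γ) ^ H * (W * stateGain γ⁻¹ κB κ)))
    (m := fun s => (𝕂 - K).toEuclideanLin (states A B (linearPolicy K) w s)) (by positivity)
    (fun s hs => states_succ_of_action_eq hs (linearPolicy_eq 𝕂 K s _)) (by omega)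
    (norm_states_linearPolicy_le { S with stable := hK } hw (by omega)).1
    fun s hs _ => S.norm_gain_sub_feedforward_imitation_le hK hw (by omega)).trans_eq ?_
  ring

lemma norm_dapPolicy_sub_trunc_le (S : StableSystem A B 𝕂 κB κ γ) {M : ℕ → Params H du dx}
    (hw : ∀ s, ‖w s‖ ≤ W) {T : ℕ}
    (hM : ∀ t, 1 ≤ t → t ≤ T → M t ∈ feasible H du dx κB κ γ) {t : ℕ} (ht : 2 * H + 2 ≤ t)
    (htT : t ≤ T) {δ : ℝ} (hδ : ∀ s, t - 1 - H ≤ s → s ≤ t → ‖M s - M t‖ ≤ δ) :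
    ‖states A B (dapPolicy 𝕂 M w) w t - truncState A B 𝕂 (M t) w t‖ +
      ‖dapPolicy 𝕂 M w t (states A B (dapPolicy 𝕂 M w) w t) - truncAction A B 𝕂 (M t) w t‖ ≤
      (1 + κ) * (κ ^ 2 * (1 - γ) ^ H * (W * stateGain γ⁻¹ κB κ)) +
        lipGain γ⁻¹ κB κ * (W * H * δ) := by
  have : 0 ≤ W := (norm_nonneg _).trans (hw 0)
  have : 0 ≤ δ := (norm_nonneg _).trans (hδ t (by omega) le_rfl)
  rw [dapPolicy_eq]
  refine S.norm_sub_trunc_le (M t)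
    (m := fun s => feedforward (Function.update w 0 0) s (M s)) (by positivity)
    (fun s hs => states_dapPolicy_succ M hs) (by omega)
    (S.norm_states_dapPolicy_le hw hM (by omega) (by omega)).1 fun s hs hst => ?_
  rw [feedforward_update_zero w (by omega), ← map_sub]
  refine (norm_feedforward_le hw _ _).trans ?_
  gcongr
  exact hδ s hs hst

end StableSystem

end Trajectories

section GradientDescent

variable {F : Type*} [NormedAddCommGroup F] [InnerProductSpace ℝ F] {C : Set F} {μ ℓ : ℝ}

open Filter Topology in
lemma sub_le_inner_gradient_sub_of_strongConvexOn [CompleteSpace F] {f : F → ℝ} {x y : F}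
    (h : StrongConvexOn C μ f) (hf : DifferentiableAt ℝ f x) (hx : x ∈ C) (hy : y ∈ C) :
    f x - f y ≤ inner ℝ (gradient f x) (x - y) - μ / 2 * ‖x - y‖ ^ 2 := by
  have deriv_along_segment :
      HasDerivAt (fun s : ℝ => f (x + s • (y - x))) (inner ℝ (gradient f x) (y - x)) 0 := by
    have hasDerivAt_segment : HasDerivAt (fun s : ℝ => x + s • (y - x)) (y - x) 0 := by
      simpa using ((hasDerivAt_id (0 : ℝ)).smul_const (y - x)).const_add x
    have hasFDerivAt_start : HasFDerivAt f (InnerProductSpace.toDual ℝ F (gradient f x))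
        (x + (0 : ℝ) • (y - x)) := by
      simpa using hf.hasGradientAt.hasFDerivAt
    exact hasFDerivAt_start.comp_hasDerivAt (0 : ℝ) hasDerivAt_segment
  have slope_tendsto : Tendsto (fun s : ℝ => s⁻¹ * (f (x + s • (y - x)) - f x)) (𝓝[>] 0)
      (𝓝 (inner ℝ (gradient f x) (y - x))) := by
    simpa using deriv_along_segment.tendsto_slope_zero_right
  have bound_tendsto : Tendsto (fun s : ℝ => f y - f x - (1 - s) * (μ / 2 * ‖x - y‖ ^ 2))
      (𝓝[>] 0) (𝓝 (f y - f x - (1 - 0) * (μ / 2 * ‖x - y‖ ^ 2))) :=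
    (Continuous.tendsto (by fun_prop) _).mono_left nhdsWithin_le_nhds
  have slope_le : ∀ᶠ s : ℝ in 𝓝[>] 0, s⁻¹ * (f (x + s • (y - x)) - f x) ≤
      f y - f x - (1 - s) * (μ / 2 * ‖x - y‖ ^ 2) := by
    filter_upwards [Ioo_mem_nhdsGT (zero_lt_one' ℝ)] with s hs
    have strong_convexity := h.2 hx hy (sub_nonneg.mpr hs.2.le) hs.1.le (sub_add_cancel 1 s)
    rw [show (1 - s) • x + s • y = x + s • (y - x) by module, smul_eq_mul, smul_eq_mul]
      at strong_convexity
    rw [inv_mul_le_iff₀ hs.1]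
    linarith
  have inner_le := le_of_tendsto_of_tendsto slope_tendsto bound_tendsto slope_le
  rw [← neg_sub y x, inner_neg_right, norm_neg, norm_sub_rev]
  linarith

lemma norm_sub_sq_le_of_dist_eq_infDist (hC : Convex ℝ C) {u v z : F} (hv : v ∈ C)
    (hz : z ∈ C) (h : dist u v = Metric.infDist u C) : ‖v - z‖ ^ 2 ≤ ‖u - z‖ ^ 2 := by
  rw [Metric.infDist_eq_iInf] at h
  simp only [dist_eq_norm] at h
  have inner_nonpos := (norm_eq_iInf_iff_real_inner_le_zero hC hv).mp h z hz
  rw [← sub_sub_sub_cancel_right u z v, norm_sub_sq_real (u - v), norm_sub_rev v z]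
  linarith [sq_nonneg ‖u - v‖]

lemma norm_sub_le_of_dist_eq_infDist {x g y : F} {η : ℝ} (hη : 0 ≤ η) (hx : x ∈ C)
    (h : dist (x - η • g) y = Metric.infDist (x - η • g) C) : ‖y - x‖ ≤ 2 * (η * ‖g‖) := by
  have step : dist (x - η • g) x = η * ‖g‖ := by
    simp [norm_smul, abs_of_nonneg hη]
  have projection : dist (x - η • g) y ≤ η * ‖g‖ := by
    rw [h, ← step]
    exact Metric.infDist_le_dist_of_mem hx
  rw [← dist_eq_norm]
  linarith [dist_triangle_left y x (x - η • g)]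

lemma sum_inv_le_one_add_log (T : ℕ) :
    ∑ t ∈ Finset.Icc 1 T, (t : ℝ)⁻¹ ≤ 1 + Real.log T := by
  simpa [harmonic_eq_sum_Icc] using harmonic_le_one_add_log T

lemma add_norm_gradient_step_sq_le (hμ : 0 < μ) {t r : ℝ} (ht : 0 < t) {x y g : F}
    (hg : ‖g‖ ≤ ℓ) (hr : r ≤ inner ℝ g (x - y) - μ / 2 * ‖x - y‖ ^ 2) :
    r + μ / 2 * t * ‖x - (μ * t)⁻¹ • g - y‖ ^ 2 ≤
      ℓ ^ 2 / (2 * μ) * t⁻¹ + μ / 2 * (t - 1) * ‖x - y‖ ^ 2 := by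
  have expand : μ / 2 * t * ‖x - (μ * t)⁻¹ • g - y‖ ^ 2 =
      μ / 2 * t * ‖x - y‖ ^ 2 - inner ℝ g (x - y) + ‖g‖ ^ 2 / (2 * μ) * t⁻¹ := by
    rw [sub_right_comm, norm_sub_sq_real (x - y), norm_smul, inner_smul_right,
      Real.norm_of_nonneg (by positivity), real_inner_comm]
    field_simp
  have norm_sq_le : ‖g‖ ^ 2 / (2 * μ) * t⁻¹ ≤ ℓ ^ 2 / (2 * μ) * t⁻¹ := by gcongr
  linarith

lemma sum_sub_le_of_projected_gradient_descent (hC : Convex ℝ C) (hμ : 0 < μ) {f : ℕ → F → ℝ}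
    {M g : ℕ → F} {T : ℕ} {N : F} (hN : N ∈ C)
    (hM : ∀ t, 1 ≤ t → t < T → M (t + 1) ∈ C ∧ dist (M t - (μ * t)⁻¹ • g t) (M (t + 1)) =
      Metric.infDist (M t - (μ * t)⁻¹ • g t) C)
    (hg : ∀ t, 1 ≤ t → t ≤ T → ‖g t‖ ≤ ℓ)
    (hf : ∀ t, 1 ≤ t → t ≤ T → f t (M t) - f t N ≤
      inner ℝ (g t) (M t - N) - μ / 2 * ‖M t - N‖ ^ 2) :
    ∑ t ∈ Finset.Icc 1 T, (f t (M t) - f t N) ≤ ℓ ^ 2 / (2 * μ) * (1 + Real.log T) := by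
  have potential (n : ℕ) (hn : n ≤ T) : ∑ t ∈ Finset.Icc 1 n, (f t (M t) - f t N) +
      μ / 2 * n * ‖M n - (μ * n)⁻¹ • g n - N‖ ^ 2 ≤
        ℓ ^ 2 / (2 * μ) * ∑ t ∈ Finset.Icc 1 n, (t : ℝ)⁻¹ := by
    induction n with
    | zero => simp
    | succ n ih =>
      have projection : μ / 2 * n * ‖M (n + 1) - N‖ ^ 2 ≤
          μ / 2 * n * ‖M n - (μ * n)⁻¹ • g n - N‖ ^ 2 := by
        rcases n.eq_zero_or_pos with rfl | n_pos
        · simp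
        · obtain ⟨mem, nearest⟩ := hM n n_pos hn
          exact mul_le_mul_of_nonneg_left
            (norm_sub_sq_le_of_dist_eq_infDist hC mem hN nearest) (by positivity)
      have step := add_norm_gradient_step_sq_le hμ (Nat.cast_pos.mpr n.succ_pos)
        (hg _ n.succ_pos hn) (hf _ n.succ_pos hn)
      rw [Nat.cast_succ, add_sub_cancel_right] at step
      rw [Finset.sum_Icc_succ_top (by omega), Finset.sum_Icc_succ_top (by omega), Nat.cast_succ]
      linarith [ih (by omega)]
  have : 0 ≤ μ / 2 * T * ‖M T - (μ * T)⁻¹ • g T - N‖ ^ 2 := by positivity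
  calc _ ≤ ℓ ^ 2 / (2 * μ) * ∑ t ∈ Finset.Icc 1 T, (t : ℝ)⁻¹ := by linarith [potential T le_rfl]
    _ ≤ _ := by
      gcongr
      exact sum_inv_le_one_add_log T

lemma norm_iterate_sub_le {M g : ℕ → F} (hμ : 0 < μ) {T : ℕ}
    (hM : ∀ t, 1 ≤ t → t ≤ T → M t ∈ C)
    (hstep : ∀ t, 1 ≤ t → t < T → dist (M t - (μ * t)⁻¹ • g t) (M (t + 1)) =
      Metric.infDist (M t - (μ * t)⁻¹ • g t) C)
    (hg : ∀ t, 1 ≤ t → t ≤ T → ‖g t‖ ≤ ℓ) {s t : ℕ} (hs : 1 ≤ s) (hst : s ≤ t) (htT : t ≤ T)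
    (hts : t ≤ 2 * s) :
    ‖M s - M t‖ ≤ (t - s : ℕ) * (4 / μ * ℓ * (t : ℝ)⁻¹) := by
  have hℓ : 0 ≤ ℓ := (norm_nonneg _).trans (hg s hs (by omega))
  have dist_succ_le {k : ℕ} (hk : s ≤ k) (hkt : k < t) :
      dist (M k) (M (k + 1)) ≤ 4 / μ * ℓ * (t : ℝ)⁻¹ := by
    have k_pos : (0 : ℝ) < k := by exact_mod_cast hs.trans hk
    have t_pos : (0 : ℝ) < t := by exact_mod_cast (hs.trans hst : 0 < t)
    have inv_le : (k : ℝ)⁻¹ ≤ 2 * (t : ℝ)⁻¹ := by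
      rw [← div_eq_mul_inv, inv_le_comm₀ k_pos (by positivity), inv_div,
        div_le_iff₀ (by norm_num)]
      exact_mod_cast (by omega : t ≤ k * 2)
    rw [dist_comm, dist_eq_norm]
    calc _ ≤ 2 * ((μ * k)⁻¹ * ‖g k‖) := norm_sub_le_of_dist_eq_infDist (by positivity)
          (hM k (by omega) (by omega)) (hstep k (by omega) (by omega))
      _ = 2 / μ * ‖g k‖ * (k : ℝ)⁻¹ := by field_simp
      _ ≤ 2 / μ * ℓ * (2 * (t : ℝ)⁻¹) := by
        gcongr
        exact hg k (by omega) (by omega)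
      _ = _ := by ring
  simpa [dist_eq_norm] using dist_le_Ico_sum_of_dist_le hst dist_succ_le

end GradientDescent

section Noise

variable {dx : ℕ} {𝒟 : Measure (EuclideanSpace ℝ (Fin dx))} {σ W : ℝ}

namespace NoiseLaw

lemma W_nonneg (h : NoiseLaw 𝒟 σ W) : 0 ≤ W := by
  have := h.prob
  obtain ⟨x, hx⟩ := h.bounded.exists
  exact (norm_nonneg x).trans hx

lemma memLp_of_continuous (h : NoiseLaw 𝒟 σ W) {f : EuclideanSpace ℝ (Fin dx) → ℝ}
    (hf : Continuous f) (p : ENNReal) : MemLp f p 𝒟 := by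
  have := h.prob
  obtain ⟨C, hC⟩ := (isCompact_closedBall
    (0 : EuclideanSpace ℝ (Fin dx)) W).exists_bound_of_continuousOn hf.continuousOn
  refine MemLp.of_bound hf.aestronglyMeasurable C ?_
  filter_upwards [h.bounded] with x hx
  exact hC x (mem_closedBall_zero_iff.mpr hx)

lemma integrable_of_continuous (h : NoiseLaw 𝒟 σ W) {f : EuclideanSpace ℝ (Fin dx) → ℝ}
    (hf : Continuous f) : Integrable f 𝒟 :=
  memLp_one_iff_integrable.mp (h.memLp_of_continuous hf 1)

lemma integral_inner_eq_zero (h : NoiseLaw 𝒟 σ W) (r : EuclideanSpace ℝ (Fin dx)) :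
    ∫ z, inner ℝ r z ∂𝒟 = 0 := by
  have := h.prob
  have integrable_id : Integrable (fun z : EuclideanSpace ℝ (Fin dx) => z) 𝒟 :=
    Integrable.of_bound continuous_id.aestronglyMeasurable W h.bounded
  rw [integral_inner integrable_id, h.mean_zero, inner_zero_right]

lemma integral_inner_sq (h : NoiseLaw 𝒟 σ W) (r : EuclideanSpace ℝ (Fin dx)) :
    ∫ z, (inner ℝ r z) ^ 2 ∂𝒟 =
      r.ofLp ⬝ᵥ (Matrix.of fun i j : Fin dx => ∫ x, x i * x j ∂𝒟) *ᵥ r.ofLp := by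
  have integrable_mul (i j : Fin dx) :
      Integrable (fun z : EuclideanSpace ℝ (Fin dx) => r i * r j * (z i * z j)) 𝒟 :=
    h.integrable_of_continuous (by fun_prop)
  have inner_sq (z : EuclideanSpace ℝ (Fin dx)) :
      (inner ℝ r z) ^ 2 = ∑ i, ∑ j, r i * r j * (z i * z j) := by
    rw [PiLp.inner_apply, sq, Finset.sum_mul_sum]
    refine Finset.sum_congr rfl fun i _ => Finset.sum_congr rfl fun j _ => ?_
    simp only [RCLike.inner_apply, conj_trivial]
    ring
  simp_rw [inner_sq]
  rw [integral_finsetSum _ fun i _ => integrable_finsetSum _ fun j _ => integrable_mul i j]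
  refine Finset.sum_congr rfl fun i _ => ?_
  rw [integral_finsetSum _ fun j _ => integrable_mul i j, Matrix.mulVec, dotProduct,
    Finset.mul_sum]
  refine Finset.sum_congr rfl fun j _ => ?_
  rw [integral_const_mul, Matrix.of_apply]
  ring

lemma le_integral_inner_sq (h : NoiseLaw 𝒟 σ W) (r : EuclideanSpace ℝ (Fin dx)) :
    σ ^ 2 * ‖r‖ ^ 2 ≤ ∫ z, (inner ℝ r z) ^ 2 ∂𝒟 := by
  have dotProduct_self : r.ofLp ⬝ᵥ r.ofLp = ‖r‖ ^ 2 := by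
    simp [EuclideanSpace.real_norm_sq_eq, dotProduct, ← sq]
  have cov_nonneg := h.cov.dotProduct_mulVec_nonneg r.ofLp
  rw [star_trivial, Matrix.sub_mulVec, dotProduct_sub, Matrix.smul_mulVec, Matrix.one_mulVec,
    dotProduct_smul, smul_eq_mul, dotProduct_self, ← h.integral_inner_sq] at cov_nonneg
  exact sub_nonneg.mp cov_nonneg

lemma sigma_sq_le (h : NoiseLaw 𝒟 σ W) (hdx : 0 < dx) : σ ^ 2 ≤ W ^ 2 := by
  have := h.prob
  set e : EuclideanSpace ℝ (Fin dx) := EuclideanSpace.single ⟨0, hdx⟩ 1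
  have norm_e : ‖e‖ = 1 := by simp [e]
  calc σ ^ 2 ≤ ∫ z, (inner ℝ e z) ^ 2 ∂𝒟 := by simpa [norm_e] using h.le_integral_inner_sq e
    _ ≤ ∫ _z, W ^ 2 ∂𝒟 := by
      refine integral_mono_ae (h.integrable_of_continuous (by fun_prop)) (integrable_const _) ?_
      filter_upwards [h.bounded] with z hz
      refine sq_le_sq.mpr ((abs_real_inner_le_norm e z).trans ?_)
      rw [norm_e, one_mul]
      exact hz.trans (le_abs_self W)
    _ = W ^ 2 := by simp

variable {ι : Type*} [Fintype ι]

lemma ae_pi_norm_le (h : NoiseLaw 𝒟 σ W) :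
    ∀ᵐ w ∂(Measure.pi fun _ : ι => 𝒟), ∀ i, ‖w i‖ ≤ W := by
  have := h.prob
  exact ae_all_iff.mpr fun i =>
    (measurePreserving_eval (fun _ : ι => 𝒟) i).quasiMeasurePreserving.ae h.bounded

lemma le_integral_sum_inner_sq (h : NoiseLaw 𝒟 σ W) (r : ι → EuclideanSpace ℝ (Fin dx)) :
    σ ^ 2 * ∑ i, ‖r i‖ ^ 2 ≤
      ∫ w, (∑ i, inner ℝ (r i) (w i)) ^ 2 ∂(Measure.pi fun _ : ι => 𝒟) := by
  have := h.prob
  have le_variance (i : ι) : σ ^ 2 * ‖r i‖ ^ 2 ≤ variance (fun z => inner ℝ (r i) z) 𝒟 := by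
    rw [variance_of_integral_eq_zero (by fun_prop) (h.integral_inner_eq_zero _)]
    exact h.le_integral_inner_sq (r i)
  calc _ = ∑ i, σ ^ 2 * ‖r i‖ ^ 2 := Finset.mul_sum _ _ _
    _ ≤ ∑ i, variance (fun z => inner ℝ (r i) z) 𝒟 :=
      Finset.sum_le_sum fun i _ => le_variance i
    _ = variance (∑ i, fun w : ι → EuclideanSpace ℝ (Fin dx) => inner ℝ (r i) (w i))
        (Measure.pi fun _ => 𝒟) :=
      (variance_sum_pi fun _ => h.memLp_of_continuous (by fun_prop) 2).symm
    _ ≤ ∫ w, ((∑ i, fun w : ι → EuclideanSpace ℝ (Fin dx) => inner ℝ (r i) (w i)) ^ 2) w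
        ∂(Measure.pi fun _ : ι => 𝒟) :=
      variance_le_expectation_sq <| Finset.aestronglyMeasurable_sum _ fun i _ =>
        Continuous.aestronglyMeasurable (by fun_prop)
    _ = _ := by simp

end NoiseLaw

end Noise

section Continuity

variable {H dx du : ℕ} {A : Matrix (Fin dx) (Fin dx) ℝ} {B : Matrix (Fin dx) (Fin du) ℝ}
  {𝕂 K : Matrix (Fin du) (Fin dx) ℝ}

lemma continuous_toEuclideanLin {m n : ℕ} (A : Matrix (Fin m) (Fin n) ℝ) :
    Continuous A.toEuclideanLin :=
  LinearMap.continuous_of_finiteDimensional _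

lemma continuous_feedforward (s : ℕ) :
    Continuous fun p : Params H du dx × (ℕ → EuclideanSpace ℝ (Fin dx)) =>
      feedforward p.2 s p.1 := by
  simp only [feedforward_apply, Matrix.toLpLin_apply]
  refine continuous_finsetSum _ fun k _ => (PiLp.continuous_toLp 2 _).comp ?_
  exact ((blkₗ k).continuous_of_finiteDimensional.comp continuous_fst).matrix_mulVec
    ((PiLp.continuous_ofLp 2 _).comp ((continuous_apply _).comp continuous_snd))

lemma continuous_truncState (t : ℕ) :
    Continuous fun p : Params H du dx × (ℕ → EuclideanSpace ℝ (Fin dx)) =>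
      truncState A B 𝕂 p.1 p.2 t := by
  simp only [truncState, response_apply]
  refine continuous_finsetSum _ fun j _ => (LinearMap.continuous_of_finiteDimensional _).comp ?_
  exact ((continuous_apply (t - 1 - j)).comp continuous_snd).add
    ((continuous_toEuclideanLin B).comp (continuous_feedforward _))

lemma continuous_truncAction (t : ℕ) :
    Continuous fun p : Params H du dx × (ℕ → EuclideanSpace ℝ (Fin dx)) =>
      truncAction A B 𝕂 p.1 p.2 t :=
  ((continuous_toEuclideanLin 𝕂).comp (continuous_truncState t)).neg.add (continuous_feedforward t)

lemma continuous_feedforward_left (M : Params H du dx) (s : ℕ) :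
    Continuous fun e : ℕ → EuclideanSpace ℝ (Fin dx) => feedforward e s M := by
  simp only [feedforward_apply]
  exact continuous_finsetSum _ fun k _ => (continuous_toEuclideanLin _).comp (continuous_apply _)

lemma continuous_feedforward_update_zero (M : Params H du dx) (t : ℕ) :
    Continuous fun e : ℕ → EuclideanSpace ℝ (Fin dx) =>
      feedforward (Function.update e 0 0) t M :=
  (continuous_feedforward_left M t).comp
    (g := fun e : ℕ → EuclideanSpace ℝ (Fin dx) => feedforward e t M)
    (continuous_id.update 0 continuous_const)

lemma continuous_states_dapPolicy (M : ℕ → Params H du dx) {t : ℕ} (ht : 1 ≤ t) :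
    Continuous fun e : ℕ → EuclideanSpace ℝ (Fin dx) => states A B (dapPolicy 𝕂 M e) e t := by
  induction t, ht using Nat.le_induction with
  | base => exact continuous_const
  | succ t ht ih =>
    simp only [states_dapPolicy_succ M ht]
    exact ((LinearMap.continuous_of_finiteDimensional _).comp ih).add ((continuous_apply t).add
      ((continuous_toEuclideanLin B).comp (continuous_feedforward_update_zero (M t) t)))

lemma continuous_dapPolicy (M : ℕ → Params H du dx) {t : ℕ} (ht : 1 ≤ t) :
    Continuous fun e : ℕ → EuclideanSpace ℝ (Fin dx) =>
      dapPolicy 𝕂 M e t (states A B (dapPolicy 𝕂 M e) e t) := by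
  simp only [dapPolicy_eq]
  exact ((continuous_toEuclideanLin 𝕂).comp (continuous_states_dapPolicy M ht)).neg.add
    (continuous_feedforward_update_zero (M t) t)

lemma continuous_states_linearPolicy {t : ℕ} (ht : 1 ≤ t) :
    Continuous fun e : ℕ → EuclideanSpace ℝ (Fin dx) => states A B (linearPolicy K) e t := by
  induction t, ht using Nat.le_induction with
  | base => exact continuous_const
  | succ t ht ih =>
    simp only [states_linearPolicy_succ ht]
    exact ((LinearMap.continuous_of_finiteDimensional _).comp ih).add (continuous_apply t)

lemma continuous_linearPolicy {t : ℕ} (ht : 1 ≤ t) :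
    Continuous fun e : ℕ → EuclideanSpace ℝ (Fin dx) =>
      linearPolicy K t (states A B (linearPolicy K) e t) :=
  ((continuous_toEuclideanLin K).comp (continuous_states_linearPolicy ht)).neg

end Continuity

section NoiseSequences

variable {n dx : ℕ} {W σ : ℝ} {𝒟 : Measure (EuclideanSpace ℝ (Fin dx))}

lemma integrable_comp_of_ae_norm_le {X : Type*} [MeasurableSpace X] {μ : Measure X}
    [IsFiniteMeasure μ] {e : X → ℕ → EuclideanSpace ℝ (Fin dx)} (he : Measurable e)
    (hb : ∀ᵐ x ∂μ, ∀ s, ‖e x s‖ ≤ W) {g : (ℕ → EuclideanSpace ℝ (Fin dx)) → ℝ}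
    (hg : Continuous g) : Integrable (fun x => g (e x)) μ := by
  have hc : IsCompact (Set.univ.pi fun _ : ℕ =>
      Metric.closedBall (0 : EuclideanSpace ℝ (Fin dx)) W) :=
    isCompact_univ_pi fun _ => isCompact_closedBall _ _
  obtain ⟨C, hC⟩ := hc.exists_bound_of_continuousOn hg.continuousOn
  refine Integrable.of_bound (hg.measurable.comp he).aestronglyMeasurable C ?_
  filter_upwards [hb] with x hx
  exact hC _ fun s _ => mem_closedBall_zero_iff.mpr (hx s)

variable [NeZero n]

/-- A finite noise vector, continued periodically to a sequence indexed by time. -/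
def periodize (v : Fin n → EuclideanSpace ℝ (Fin dx)) (s : ℕ) : EuclideanSpace ℝ (Fin dx) :=
  v (Fin.ofNat n s)

lemma continuous_periodize :
    Continuous (periodize : (Fin n → EuclideanSpace ℝ (Fin dx)) → _) :=
  continuous_pi fun _ => continuous_apply _

lemma NoiseLaw.ae_norm_periodize_le (h : NoiseLaw 𝒟 σ W) :
    ∀ᵐ v ∂(Measure.pi fun _ : Fin n => 𝒟), ∀ s, ‖periodize v s‖ ≤ W := by
  filter_upwards [h.ae_pi_norm_le] with v hv s using hv _

lemma NoiseLaw.integrable_comp_periodize (h : NoiseLaw 𝒟 σ W)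
    {g : (ℕ → EuclideanSpace ℝ (Fin dx)) → ℝ} (hg : Continuous g) :
    Integrable (fun v => g (periodize v)) (Measure.pi fun _ : Fin n => 𝒟) := by
  have := h.prob
  exact integrable_comp_of_ae_norm_le continuous_periodize.measurable h.ae_norm_periodize_le hg

end NoiseSequences

section Surrogate

variable {H dx du : ℕ} {A : Matrix (Fin dx) (Fin dx) ℝ} {B : Matrix (Fin dx) (Fin du) ℝ}
  {𝕂 : Matrix (Fin du) (Fin dx) ℝ} {α G : ℝ}
  {𝒟 : Measure (EuclideanSpace ℝ (Fin dx))}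
  {c : EuclideanSpace ℝ (Fin dx) → EuclideanSpace ℝ (Fin du) → ℝ}

variable (A B 𝕂) in
/-- The cost of the surrogate state and action at time `t` along a noise sequence. -/
def truncCost (c : EuclideanSpace ℝ (Fin dx) → EuclideanSpace ℝ (Fin du) → ℝ)
    (M : Params H du dx) (e : ℕ → EuclideanSpace ℝ (Fin dx)) (t : ℕ) : ℝ :=
  c (truncState A B 𝕂 M e t) (truncAction A B 𝕂 M e t)

lemma CostClass.continuous_uncurry_truncCost (hc : CostClass α G c) (t : ℕ) :
    Continuous fun p : Params H du dx × (ℕ → EuclideanSpace ℝ (Fin dx)) =>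
      truncCost A B 𝕂 c p.1 p.2 t :=
  hc.continuous.comp ((continuous_truncState t).prodMk (continuous_truncAction t))

lemma CostClass.continuous_truncCost (hc : CostClass α G c) (M : Params H du dx) (t : ℕ) :
    Continuous fun e : ℕ → EuclideanSpace ℝ (Fin dx) => truncCost A B 𝕂 c M e t :=
  (hc.continuous_uncurry_truncCost t).comp (continuous_const.prodMk continuous_id)

lemma truncCost_eq (M : Params H du dx) (e : ℕ → EuclideanSpace ℝ (Fin dx)) {t : ℕ}
    (ht : 2 * H + 1 ≤ t) :
    truncCost A B 𝕂 c M e t =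
      c (surrogateState A B 𝕂 (fun _ => M) fun i => e (t - 1 - 2 * H + i))
        (surrogateAction A B 𝕂 (fun _ => M) fun i => e (t - 1 - 2 * H + i)) := by
  rw [surrogateState_eq M e ht, surrogateAction_eq M e ht, truncCost]

lemma truncCost_periodize (M : Params H du dx)
    (v : Fin (2 * H + 1) → EuclideanSpace ℝ (Fin dx)) :
    truncCost A B 𝕂 c M (periodize v) (2 * H + 1) =
      c (surrogateState A B 𝕂 (fun _ => M) v) (surrogateAction A B 𝕂 (fun _ => M) v) := by
  have shift : (fun i : Fin (2 * H + 1) => periodize v (2 * H + 1 - 1 - 2 * H + i)) = v := by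
    ext1 i
    rw [Nat.add_sub_cancel, Nat.sub_self, zero_add, periodize, Fin.ofNat_val_eq_self]
  rw [truncCost_eq M _ le_rfl, shift]

lemma surrogateCost_eq (M : Params H du dx) :
    surrogateCost A B 𝕂 𝒟 c M = ∫ v, truncCost A B 𝕂 c M (periodize v) (2 * H + 1)
      ∂(Measure.pi fun _ : Fin (2 * H + 1) => 𝒟) := by
  simp only [truncCost_periodize, surrogateCost]

lemma surrogateCost_eq_expectation {Ω : Type*} [MeasurableSpace Ω] {P : Measure Ω}
    {w : ℕ → Ω → EuclideanSpace ℝ (Fin dx)} (hw : ∀ t, Measurable (w t))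
    (hlaw : ∀ t, P.map (w t) = 𝒟) (hind : iIndepFun w P) (hc : CostClass α G c)
    (M : Params H du dx) {t : ℕ} (ht : 2 * H + 1 ≤ t) :
    surrogateCost A B 𝕂 𝒟 c M = ∫ ω, truncCost A B 𝕂 c M (fun s => w s ω) t ∂P := by
  have := hind.isProbabilityMeasure
  have hinj : Function.Injective fun i : Fin (2 * H + 1) => t - 1 - 2 * H + (i : ℕ) :=
    fun i j h => Fin.ext (Nat.add_left_cancel h)
  have hmap := (iIndepFun_iff_map_fun_eq_pi_map fun i => (hw _).aemeasurable).mp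
    (hind.precomp hinj)
  have hcont : Continuous fun v : Fin (2 * H + 1) → EuclideanSpace ℝ (Fin dx) =>
      c (surrogateState A B 𝕂 (fun _ => M) v) (surrogateAction A B 𝕂 (fun _ => M) v) := by
    simp only [← truncCost_periodize]
    exact (hc.continuous_truncCost M _).comp continuous_periodize
  simp only [hlaw] at hmap
  simp only [surrogateCost, truncCost_eq M _ ht]
  rw [← hmap, integral_map (measurable_pi_lambda _ fun i => hw _).aemeasurable
    hcont.aestronglyMeasurable]

end Surrogate

section ParameterDependence

variable {H dx du : ℕ} {A : Matrix (Fin dx) (Fin dx) ℝ} {B : Matrix (Fin dx) (Fin du) ℝ}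
  {𝕂 : Matrix (Fin du) (Fin dx) ℝ} {α G : ℝ}
  {c : EuclideanSpace ℝ (Fin dx) → EuclideanSpace ℝ (Fin du) → ℝ}

variable (A B 𝕂) in
/-- The pair of surrogate state and action at time `t` depends affinely on the parameters: a linear
part, plus the response to the noise under the policy `-𝕂 x`. -/
def truncMap (e : ℕ → EuclideanSpace ℝ (Fin dx)) (t : ℕ) :
    Params H du dx →ᵃ[ℝ] EuclideanSpace ℝ (Fin dx) × EuclideanSpace ℝ (Fin du) :=
  let Λ : Params H du dx →ₗ[ℝ] EuclideanSpace ℝ (Fin dx) :=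
    response (closedLoop A B 𝕂) (H + 1) t ∘ₗ
      LinearMap.pi fun s => B.toEuclideanLin ∘ₗ feedforward e s
  let x := response (closedLoop A B 𝕂) (H + 1) t e
  (Λ.prod (-(𝕂.toEuclideanLin ∘ₗ Λ) + feedforward e t)).toAffineMap +
    AffineMap.const ℝ (Params H du dx) (x, -𝕂.toEuclideanLin x)

lemma truncMap_apply (e : ℕ → EuclideanSpace ℝ (Fin dx)) (t : ℕ) (M : Params H du dx) :
    truncMap A B 𝕂 e t M = (truncState A B 𝕂 M e t, truncAction A B 𝕂 M e t) := by
  have truncState_eq : truncState A B 𝕂 M e t =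
      response (closedLoop A B 𝕂) (H + 1) t (fun s => B.toEuclideanLin (feedforward e s M)) +
        response (closedLoop A B 𝕂) (H + 1) t e := by
    rw [← map_add, truncState]
    congr 1
    exact funext fun s => add_comm _ _
  rw [truncAction, truncState_eq, map_add, neg_add_rev, add_comm (-_) (-_), add_right_comm]
  rfl

lemma CostClass.differentiable_truncCost (hc : CostClass α G c)
    (e : ℕ → EuclideanSpace ℝ (Fin dx)) (t : ℕ) :
    Differentiable ℝ fun M : Params H du dx => truncCost A B 𝕂 c M e t := by
  let f : Params H du dx →ᴬ[ℝ] EuclideanSpace ℝ (Fin dx) × EuclideanSpace ℝ (Fin du) :=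
    ⟨truncMap A B 𝕂 e t, AffineMap.continuous_of_finiteDimensional _⟩
  have truncCost_eq : (fun M => truncCost A B 𝕂 c M e t) = (fun z => c z.1 z.2) ∘ f := by
    ext1 M
    simp only [f, Function.comp_apply, ContinuousAffineMap.coe_mk, truncMap_apply, truncCost]
  rw [truncCost_eq]
  exact hc.diff.comp f.differentiable

lemma CostClass.truncCost_combo_le (hc : CostClass α G c) (M N : Params H du dx)
    (e : ℕ → EuclideanSpace ℝ (Fin dx)) (t : ℕ) {a b : ℝ} (ha : 0 ≤ a) (hb : 0 ≤ b)
    (hab : a + b = 1) :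
    truncCost A B 𝕂 c (a • M + b • N) e t ≤
      a * truncCost A B 𝕂 c M e t + b * truncCost A B 𝕂 c N e t -
        a * b * (α / 2 * (‖truncState A B 𝕂 M e t - truncState A B 𝕂 N e t‖ ^ 2 +
          ‖truncAction A B 𝕂 M e t - truncAction A B 𝕂 N e t‖ ^ 2)) := by
  have combo := Convex.combo_affine_apply (x := M) (y := N) (f := truncMap A B 𝕂 e t) hab
  simp only [truncMap_apply, Prod.smul_mk, Prod.mk_add_mk, Prod.mk.injEq] at combo
  rw [truncCost, combo.1, combo.2]
  exact hc.strong_convexity _ _ _ _ ha hb hab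

end ParameterDependence

section Gradient

variable {H dx du : ℕ} {A : Matrix (Fin dx) (Fin dx) ℝ} {B : Matrix (Fin dx) (Fin du) ℝ}
  {𝕂 : Matrix (Fin du) (Fin dx) ℝ} {κB κ γ W σ α G : ℝ}
  {𝒟 : Measure (EuclideanSpace ℝ (Fin dx))}
  {c : EuclideanSpace ℝ (Fin dx) → EuclideanSpace ℝ (Fin du) → ℝ}

/-- A bound on the gradients of the surrogate costs on the feasible set, with `g = γ⁻¹`. -/
def surrogateLip (g κB κ G W : ℝ) (H : ℕ) : ℝ :=
  2 * G * stateGain g κB κ * lipGain g κB κ * W ^ 2 * H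

namespace StableSystem

lemma surrogateLip_nonneg (S : StableSystem A B 𝕂 κB κ γ) (hG : 0 ≤ G) :
    0 ≤ surrogateLip γ⁻¹ κB κ G W H := by
  have := S.stateGain_pos
  have := S.lipGain_pos
  unfold surrogateLip
  positivity

lemma exists_lipschitzOnWith_truncCost (S : StableSystem A B 𝕂 κB κ γ) (hc : CostClass α G c)
    {M : Params H du dx} (hM : M ∈ feasible H du dx κB κ γ) :
    ∃ s ∈ nhds M, ∀ (e : ℕ → EuclideanSpace ℝ (Fin dx)), (∀ i, ‖e i‖ ≤ W) → ∀ t,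
      LipschitzOnWith (Real.nnabs (surrogateLip γ⁻¹ κB κ G W H))
        (fun N => truncCost A B 𝕂 c N e t) s := by
  have hG := hc.G_nonneg
  have := S.stateGain_pos
  refine ⟨{N | lipGain γ⁻¹ κB κ * (H * ‖N - M‖) ≤ stateGain γ⁻¹ κB κ}, ?_, fun e he t => ?_⟩
  · have : Continuous fun N : Params H du dx => lipGain γ⁻¹ κB κ * (H * ‖N - M‖) := by fun_prop
    exact this.continuousAt.eventually_le_const (by simpa using S.stateGain_pos)
  have hW : 0 ≤ W := (norm_nonneg _).trans (he 0)
  have norm_le {N : Params H du dx} (hN : lipGain γ⁻¹ κB κ * (H * ‖N - M‖) ≤ stateGain γ⁻¹ κB κ) :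
      ‖truncState A B 𝕂 N e t‖ ≤ 2 * (W * stateGain γ⁻¹ κB κ) ∧
      ‖truncAction A B 𝕂 N e t‖ ≤ 2 * (W * stateGain γ⁻¹ κB κ) := by
    obtain ⟨state_le, action_le⟩ := S.norm_truncState_le_and_norm_truncAction_le hM he t
    have sub_le := S.norm_trunc_sub_le N M he t
    have := mul_le_mul_of_nonneg_left hN hW
    have := norm_sub_norm_le (truncState A B 𝕂 N e t) (truncState A B 𝕂 M e t)
    have := norm_sub_norm_le (truncAction A B 𝕂 N e t) (truncAction A B 𝕂 M e t)
    have := norm_nonneg (truncState A B 𝕂 N e t - truncState A B 𝕂 M e t)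
    have := norm_nonneg (truncAction A B 𝕂 N e t - truncAction A B 𝕂 M e t)
    constructor <;> linarith
  refine LipschitzOnWith.of_dist_le_mul fun N hN N' hN' => ?_
  rw [Real.coe_nnabs, abs_of_nonneg (S.surrogateLip_nonneg hG), dist_eq_norm, dist_eq_norm]
  calc _ ≤ G * (2 * (W * stateGain γ⁻¹ κB κ)) * (lipGain γ⁻¹ κB κ * (W * H * ‖N - N'‖)) :=
        (hc.abs_sub_le (norm_le hN).1 (norm_le hN').1 (norm_le hN).2 (norm_le hN').2).trans
          (mul_le_mul_of_nonneg_left (S.norm_trunc_sub_le N N' he t) (by positivity))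
    _ = surrogateLip γ⁻¹ κB κ G W H * ‖N - N'‖ := by unfold surrogateLip; ring

lemma exists_hasFDerivAt_surrogateCost (S : StableSystem A B 𝕂 κB κ γ) (hc : CostClass α G c)
    (h𝒟 : NoiseLaw 𝒟 σ W) {M : Params H du dx} (hM : M ∈ feasible H du dx κB κ γ) :
    ∃ f' : Params H du dx →L[ℝ] ℝ, HasFDerivAt (surrogateCost A B 𝕂 𝒟 c) f' M ∧
      ‖f'‖ ≤ surrogateLip γ⁻¹ κB κ G W H := by
  have := h𝒟.prob
  set ν := Measure.pi fun _ : Fin (2 * H + 1) => 𝒟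
  let F (v : Fin (2 * H + 1) → EuclideanSpace ℝ (Fin dx)) (N : Params H du dx) : ℝ :=
    truncCost A B 𝕂 c N (periodize v) (2 * H + 1)
  have hF : Continuous (Function.uncurry F) := (hc.continuous_uncurry_truncCost (2 * H + 1)).comp
    (continuous_snd.prodMk (continuous_periodize.comp continuous_fst))
  have hF' v : HasFDerivAt (F v) (fderiv ℝ (F v) M) M :=
    (hc.differentiable_truncCost (periodize v) _ M).hasFDerivAt
  obtain ⟨s, hs, lipschitz⟩ := S.exists_lipschitzOnWith_truncCost (B := B) hc hM
  have lipschitz_ae : ∀ᵐ v ∂ν,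
      LipschitzOnWith (Real.nnabs (surrogateLip γ⁻¹ κB κ G W H)) (F v) s := by
    filter_upwards [h𝒟.ae_norm_periodize_le] with v hv using lipschitz _ hv _
  refine ⟨∫ v, fderiv ℝ (F v) M ∂ν, ?_, ?_⟩
  · rw [funext surrogateCost_eq]
    exact (hasFDerivAt_integral_of_dominated_loc_of_lip (F := fun N v => F v N) hs
      (.of_forall fun N => (hF.comp (.prodMk_left N)).aestronglyMeasurable)
      (h𝒟.integrable_comp_periodize (hc.continuous_truncCost M _))
      ((measurable_fderiv_with_param ℝ hF).comp measurable_prodMk_right).aestronglyMeasurable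
      lipschitz_ae (integrable_const _) (.of_forall hF')).2
  · refine (norm_integral_le_of_norm_le_const ?_).trans_eq (by rw [probReal_univ, mul_one])
    filter_upwards [lipschitz_ae] with v hv
    have := (hF' v).le_of_lipschitzOn hs hv
    rwa [Real.coe_nnabs, abs_of_nonneg (S.surrogateLip_nonneg hc.G_nonneg)] at this

lemma differentiableAt_surrogateCost (S : StableSystem A B 𝕂 κB κ γ) (hc : CostClass α G c)
    (h𝒟 : NoiseLaw 𝒟 σ W) {M : Params H du dx} (hM : M ∈ feasible H du dx κB κ γ) :
    DifferentiableAt ℝ (surrogateCost A B 𝕂 𝒟 c) M :=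
  let ⟨_, h, _⟩ := S.exists_hasFDerivAt_surrogateCost hc h𝒟 hM
  h.differentiableAt

lemma norm_gradient_surrogateCost_le (S : StableSystem A B 𝕂 κB κ γ) (hc : CostClass α G c)
    (h𝒟 : NoiseLaw 𝒟 σ W) {M : Params H du dx} (hM : M ∈ feasible H du dx κB κ γ) :
    ‖gradient (surrogateCost A B 𝕂 𝒟 c) M‖ ≤ surrogateLip γ⁻¹ κB κ G W H := by
  obtain ⟨f', h, norm_le⟩ := S.exists_hasFDerivAt_surrogateCost hc h𝒟 hM
  rwa [gradient, LinearIsometryEquiv.norm_map, h.fderiv]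

end StableSystem

end Gradient

section StrongConvexity

variable {H dx du : ℕ} {A : Matrix (Fin dx) (Fin dx) ℝ} {B : Matrix (Fin dx) (Fin du) ℝ}
  {𝕂 : Matrix (Fin du) (Fin dx) ℝ} {κB κ γ W σ α G : ℝ}
  {𝒟 : Measure (EuclideanSpace ℝ (Fin dx))}
  {c : EuclideanSpace ℝ (Fin dx) → EuclideanSpace ℝ (Fin du) → ℝ}

/-- The `a`-th row of the `k`-th block of the parameters. -/
def blkRow (M : Params H du dx) (k : ℕ) (a : Fin du) : EuclideanSpace ℝ (Fin dx) :=
  WithLp.toLp 2 (blk M k a)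

lemma blkRow_of_le (M : Params H du dx) {k : ℕ} (hk : H ≤ k) (a : Fin du) : blkRow M k a = 0 := by
  rw [blkRow, blk, dif_neg hk.not_gt]
  rfl

lemma sum_fin_rev_eq_sum_range {n N : ℕ} (hn : n ≤ N) {f : ℕ → ℝ} (hf : ∀ k, n ≤ k → f k = 0) :
    ∑ i : Fin N, f i.rev = ∑ k ∈ Finset.range n, f k := by
  change ∑ i : Fin N, f (Fin.revPerm i) = _
  rw [Equiv.sum_comp Fin.revPerm fun i : Fin N => f i, ← Finset.sum_range]
  exact (Finset.sum_subset (Finset.range_subset_range.mpr hn) fun k _ hk =>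
    hf k (not_lt.mp (Finset.mem_range.not.mp hk))).symm

lemma feedforward_periodize_apply (M : Params H du dx)
    (v : Fin (2 * H + 1) → EuclideanSpace ℝ (Fin dx)) (a : Fin du) :
    feedforward (periodize v) (2 * H + 1) M a = ∑ i, inner ℝ (blkRow M i.rev a) (v i) := by
  have term_eq (i : Fin (2 * H + 1)) : inner ℝ (blkRow M i.rev a) (v i) =
      inner ℝ (blkRow M i.rev a) (periodize v (2 * H + 1 - 1 - i.rev)) := by
    rw [periodize, Fin.val_rev, show 2 * H + 1 - 1 - (2 * H + 1 - (i + 1)) = i by omega,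
      Fin.ofNat_val_eq_self]
  simp only [term_eq]
  rw [sum_fin_rev_eq_sum_range
    (f := fun k => inner ℝ (blkRow M k a) (periodize v (2 * H + 1 - 1 - k))) (n := H) (by omega)
    fun k hk => by rw [blkRow_of_le M hk, inner_zero_left],
    feedforward_apply, WithLp.ofLp_sum, Finset.sum_apply]
  refine Finset.sum_congr rfl fun k _ => ?_
  rw [PiLp.inner_apply]
  simp [Matrix.mulVec, dotProduct, blkRow, mul_comm]

lemma norm_sq_eq_sum_blkRow (M : Params H du dx) :
    ‖M‖ ^ 2 = ∑ a, ∑ i : Fin (2 * H + 1), ‖blkRow M i.rev a‖ ^ 2 := by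
  rw [norm_sq_eq_sum_blk, Finset.sum_comm]
  refine Finset.sum_congr rfl fun a _ => ?_
  rw [sum_fin_rev_eq_sum_range (f := fun k => ‖blkRow M k a‖ ^ 2) (n := H) (by omega)
    fun k hk => by rw [blkRow_of_le M hk, norm_zero, zero_pow two_ne_zero]]
  simp only [EuclideanSpace.norm_sq_eq, blkRow]

lemma NoiseLaw.le_integral_feedforward_sq (h : NoiseLaw 𝒟 σ W) (M : Params H du dx) :
    σ ^ 2 * ‖M‖ ^ 2 ≤ ∫ v, ‖feedforward (periodize v) (2 * H + 1) M‖ ^ 2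
      ∂(Measure.pi fun _ : Fin (2 * H + 1) => 𝒟) := by
  have integrable (a : Fin du) := h.integrable_comp_periodize (n := 2 * H + 1)
    (g := fun e => feedforward e (2 * H + 1) M a ^ 2)
    (((PiLp.continuous_apply 2 _ a).comp (continuous_feedforward_left M _)).pow 2)
  simp only [EuclideanSpace.real_norm_sq_eq (feedforward _ _ _)]
  rw [integral_finsetSum _ fun a _ => integrable a, norm_sq_eq_sum_blkRow, Finset.mul_sum]
  refine Finset.sum_le_sum fun a _ => ?_
  simp only [feedforward_periodize_apply]
  exact h.le_integral_sum_inner_sq _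

lemma integral_le_combo_sub {X : Type*} [MeasurableSpace X] {μ : Measure X} {f f₁ f₂ g : X → ℝ}
    (hf : Integrable f μ) (hf₁ : Integrable f₁ μ) (hf₂ : Integrable f₂ μ) (hg : Integrable g μ)
    {a b m : ℝ} (h : ∀ x, f x ≤ a * f₁ x + b * f₂ x - m * g x) :
    ∫ x, f x ∂μ ≤ a * ∫ x, f₁ x ∂μ + b * ∫ x, f₂ x ∂μ - m * ∫ x, g x ∂μ := by
  have integrable_combo : Integrable (fun x => a * f₁ x + b * f₂ x) μ :=
    (hf₁.const_mul a).add (hf₂.const_mul b)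
  refine (integral_mono hf (integrable_combo.sub (hg.const_mul m)) h).trans_eq ?_
  rw [integral_sub' integrable_combo (hg.const_mul m),
    integral_add (hf₁.const_mul a) (hf₂.const_mul b), integral_const_mul, integral_const_mul,
    integral_const_mul]

lemma StableSystem.norm_feedforward_sub_sq_le (S : StableSystem A B 𝕂 κB κ γ)
    (M N : Params H du dx) (e : ℕ → EuclideanSpace ℝ (Fin dx)) (t : ℕ) :
    ‖feedforward e t (M - N)‖ ^ 2 ≤
      2 * κ ^ 2 * (‖truncState A B 𝕂 M e t - truncState A B 𝕂 N e t‖ ^ 2 +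
        ‖truncAction A B 𝕂 M e t - truncAction A B 𝕂 N e t‖ ^ 2) := by
  set x := truncState A B 𝕂 M e t - truncState A B 𝕂 N e t with hx
  set u := truncAction A B 𝕂 M e t - truncAction A B 𝕂 N e t with hu
  have feedforward_sub_eq : feedforward e t (M - N) = u + 𝕂.toEuclideanLin x := by
    rw [hu, hx, truncAction, truncAction, map_sub, map_sub]
    abel
  have norm_le : ‖u + 𝕂.toEuclideanLin x‖ ≤ ‖u‖ + κ * ‖x‖ :=
    norm_add_le_of_le le_rfl (norm_toEuclideanLin_le S.stable.specNorm_gain_le x)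
  calc ‖feedforward e t (M - N)‖ ^ 2 ≤ (‖u‖ + κ * ‖x‖) ^ 2 := by
        rw [feedforward_sub_eq]
        gcongr
    _ ≤ 2 * (‖u‖ ^ 2 + (κ * ‖x‖) ^ 2) := add_sq_le
    _ ≤ 2 * κ ^ 2 * (‖x‖ ^ 2 + ‖u‖ ^ 2) := by
        have := le_mul_of_one_le_left (sq_nonneg ‖u‖) (one_le_pow₀ (n := 2) S.one_le)
        linarith

lemma StableSystem.strongConvexOn_surrogateCost (S : StableSystem A B 𝕂 κB κ γ) (hα : 0 ≤ α)
    (hc : CostClass α G c) (h𝒟 : NoiseLaw 𝒟 σ W) :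
    StrongConvexOn Set.univ (α * σ ^ 2 / (2 * κ ^ 2))
      (surrogateCost A B 𝕂 𝒟 c : Params H du dx → ℝ) := by
  refine ⟨convex_univ, fun M _ N _ a b ha hb hab => ?_⟩
  have := S.kappa_pos
  have integrable_cost (N : Params H du dx) :=
    h𝒟.integrable_comp_periodize (n := 2 * H + 1)
      (hc.continuous_truncCost (A := A) (B := B) (𝕂 := 𝕂) N (2 * H + 1))
  have integrable_sq := h𝒟.integrable_comp_periodize (n := 2 * H + 1)
    (g := fun e => ‖feedforward e (2 * H + 1) (M - N)‖ ^ 2)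
    ((continuous_feedforward_left _ _).norm.pow 2)
  have pointwise (v : Fin (2 * H + 1) → EuclideanSpace ℝ (Fin dx)) :
      truncCost A B 𝕂 c (a • M + b • N) (periodize v) (2 * H + 1) ≤
        a * truncCost A B 𝕂 c M (periodize v) (2 * H + 1) +
          b * truncCost A B 𝕂 c N (periodize v) (2 * H + 1) -
        a * b * (α / (4 * κ ^ 2)) * ‖feedforward (periodize v) (2 * H + 1) (M - N)‖ ^ 2 := by
    refine (hc.truncCost_combo_le M N _ _ ha hb hab).trans (sub_le_sub_left ?_ _)
    refine (mul_le_mul_of_nonneg_left (S.norm_feedforward_sub_sq_le M N (periodize v) _)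
      (by positivity)).trans_eq ?_
    field_simp
    ring
  have integrated := integral_le_combo_sub (integrable_cost _) (integrable_cost M)
    (integrable_cost N) integrable_sq pointwise
  rw [← surrogateCost_eq, ← surrogateCost_eq, ← surrogateCost_eq] at integrated
  refine integrated.trans (sub_le_sub_left ?_ _)
  calc a * b * (α * σ ^ 2 / (2 * κ ^ 2) / 2 * ‖M - N‖ ^ 2)
      = a * b * (α / (4 * κ ^ 2)) * (σ ^ 2 * ‖M - N‖ ^ 2) := by field_simp; ring
    _ ≤ _ := mul_le_mul_of_nonneg_left (h𝒟.le_integral_feedforward_sq (M - N)) (by positivity)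

end StrongConvexity

section StepCosts

variable {H dx du T : ℕ} {A : Matrix (Fin dx) (Fin dx) ℝ} {B : Matrix (Fin dx) (Fin du) ℝ}
  {𝕂 K : Matrix (Fin du) (Fin dx) ℝ} {κB κ γ W D σ α G : ℝ}
  {𝒟 : Measure (EuclideanSpace ℝ (Fin dx))} {Ω : Type*} [MeasurableSpace Ω] {P : Measure Ω}
  {w : ℕ → Ω → EuclideanSpace ℝ (Fin dx)}
  {π : (ℕ → EuclideanSpace ℝ (Fin dx)) → ℕ → EuclideanSpace ℝ (Fin dx) →
    EuclideanSpace ℝ (Fin du)}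

/-- The noise vectors `w t` are independent with law `𝒟`, which satisfies `NoiseLaw 𝒟 σ W`. -/
structure NoiseProcess (P : Measure Ω) (𝒟 : Measure (EuclideanSpace ℝ (Fin dx))) (σ W : ℝ)
    (w : ℕ → Ω → EuclideanSpace ℝ (Fin dx)) : Prop where
  law : NoiseLaw 𝒟 σ W
  measurable : ∀ t, Measurable (w t)
  map_eq : ∀ t, P.map (w t) = 𝒟
  indep : iIndepFun w P

namespace NoiseProcess

lemma ae_norm_le (hw : NoiseProcess P 𝒟 σ W w) : ∀ᵐ ω ∂P, ∀ s, ‖w s ω‖ ≤ W :=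
  ae_all_iff.mpr fun s =>
    ae_of_ae_map (hw.measurable s).aemeasurable (hw.map_eq s ▸ hw.law.bounded)

lemma integrable_comp (hw : NoiseProcess P 𝒟 σ W w)
    {g : (ℕ → EuclideanSpace ℝ (Fin dx)) → ℝ} (hg : Continuous g) :
    Integrable (fun ω => g fun s => w s ω) P := by
  have := hw.indep.isProbabilityMeasure
  exact integrable_comp_of_ae_norm_le (measurable_pi_lambda _ hw.measurable) hw.ae_norm_le hg

lemma abs_integral_sub_integral_le (hw : NoiseProcess P 𝒟 σ W w)
    {f g : (ℕ → EuclideanSpace ℝ (Fin dx)) → ℝ} (hf : Continuous f) (hg : Continuous g) {C : ℝ}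
    (h : ∀ e, (∀ s, ‖e s‖ ≤ W) → |f e - g e| ≤ C) :
    |∫ ω, f (fun s => w s ω) ∂P - ∫ ω, g (fun s => w s ω) ∂P| ≤ C := by
  have := hw.indep.isProbabilityMeasure
  rw [← integral_sub (hw.integrable_comp hf) (hw.integrable_comp hg)]
  have ae_le : ∀ᵐ ω ∂P, ‖f (fun s => w s ω) - g fun s => w s ω‖ ≤ C :=
    hw.ae_norm_le.mono fun ω hω => h _ hω
  simpa using norm_integral_le_of_norm_le_const ae_le

end NoiseProcess

variable (A B) in
/-- The cost at time `t` of the controller `π` along a noise sequence. -/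
def pathCost (c : EuclideanSpace ℝ (Fin dx) → EuclideanSpace ℝ (Fin du) → ℝ)
    (π : (ℕ → EuclideanSpace ℝ (Fin dx)) → ℕ → EuclideanSpace ℝ (Fin dx) →
      EuclideanSpace ℝ (Fin du)) (e : ℕ → EuclideanSpace ℝ (Fin dx)) (t : ℕ) : ℝ :=
  c (states A B (π e) e t) (π e t (states A B (π e) e t))

variable (A B W D) in
/-- At time `t` the state and the action of the controller `π` depend continuously on the noise
sequence, and they are at most `D` if the noise is at most `W`. -/
structure BoundedPolicy
    (π : (ℕ → EuclideanSpace ℝ (Fin dx)) → ℕ → EuclideanSpace ℝ (Fin dx) →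
      EuclideanSpace ℝ (Fin du)) (t : ℕ) : Prop where
  continuous_state : Continuous fun e => states A B (π e) e t
  continuous_action : Continuous fun e => π e t (states A B (π e) e t)
  norm_le : ∀ e, (∀ s, ‖e s‖ ≤ W) →
    ‖states A B (π e) e t‖ ≤ D ∧ ‖π e t (states A B (π e) e t)‖ ≤ D

lemma StableSystem.boundedPolicy_dapPolicy (S : StableSystem A B 𝕂 κB κ γ)
    {M : ℕ → Params H du dx} (hM : ∀ t, 1 ≤ t → t ≤ T → M t ∈ feasible H du dx κB κ γ) {t : ℕ}
    (ht : 1 ≤ t) (htT : t ≤ T) :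
    BoundedPolicy A B W (W * stateGain γ⁻¹ κB κ) (dapPolicy 𝕂 M) t where
  continuous_state := continuous_states_dapPolicy M ht
  continuous_action := continuous_dapPolicy M ht
  norm_le _ he := S.norm_states_dapPolicy_le he hM ht htT

lemma StableSystem.boundedPolicy_linearPolicy (S : StableSystem A B K κB κ γ) {t : ℕ}
    (ht : 1 ≤ t) :
    BoundedPolicy A B W (W * stateGain γ⁻¹ κB κ) (fun _ => linearPolicy K) t where
  continuous_state := continuous_states_linearPolicy ht
  continuous_action := continuous_linearPolicy ht
  norm_le _ he := S.norm_states_linearPolicy_le he ht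

lemma BoundedPolicy.continuous_pathCost {t : ℕ} (hπ : BoundedPolicy A B W D π t)
    {c : EuclideanSpace ℝ (Fin dx) → EuclideanSpace ℝ (Fin du) → ℝ} (hc : CostClass α G c) :
    Continuous fun e => pathCost A B c π e t :=
  hc.continuous.comp (hπ.continuous_state.prodMk hπ.continuous_action)

lemma expectedCost_eq_sum (hw : NoiseProcess P 𝒟 σ W w)
    {c : ℕ → EuclideanSpace ℝ (Fin dx) → EuclideanSpace ℝ (Fin du) → ℝ}
    (hc : ∀ t, 1 ≤ t → t ≤ T → CostClass α G (c t))
    (hπ : ∀ t, 1 ≤ t → t ≤ T → BoundedPolicy A B W D π t) :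
    expectedCost A B P w c T π =
      ∑ t ∈ Finset.Icc 1 T, ∫ ω, pathCost A B (c t) π (fun s => w s ω) t ∂P := by
  refine integral_finsetSum _ fun t ht => ?_
  obtain ⟨ht1, htT⟩ := Finset.mem_Icc.mp ht
  exact hw.integrable_comp ((hπ t ht1 htT).continuous_pathCost (hc t ht1 htT))

variable {c : EuclideanSpace ℝ (Fin dx) → EuclideanSpace ℝ (Fin du) → ℝ}

lemma abs_integral_pathCost_sub_zero_le (hw : NoiseProcess P 𝒟 σ W w) (hc : CostClass α G c)
    {t : ℕ} (hπ : BoundedPolicy A B W D π t) :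
    |∫ ω, pathCost A B c π (fun s => w s ω) t ∂P - c 0 0| ≤ 2 * G * D ^ 2 := by
  have := hw.indep.isProbabilityMeasure
  simpa using hw.abs_integral_sub_integral_le (hπ.continuous_pathCost hc)
    (continuous_const (y := c 0 0)) fun e he =>
      hc.abs_sub_zero_le (hπ.norm_le e he).1 (hπ.norm_le e he).2

namespace StableSystem

lemma abs_surrogateCost_sub_zero_le (S : StableSystem A B 𝕂 κB κ γ)
    (hw : NoiseProcess P 𝒟 σ W w) (hc : CostClass α G c) {M : Params H du dx}
    (hM : M ∈ feasible H du dx κB κ γ) :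
    |surrogateCost A B 𝕂 𝒟 c M - c 0 0| ≤ 2 * G * (W * stateGain γ⁻¹ κB κ) ^ 2 := by
  have := hw.indep.isProbabilityMeasure
  rw [surrogateCost_eq_expectation hw.measurable hw.map_eq hw.indep hc M le_rfl]
  simpa using hw.abs_integral_sub_integral_le (hc.continuous_truncCost M _)
    (continuous_const (y := c 0 0)) fun e he =>
      have ⟨state_le, action_le⟩ := S.norm_truncState_le_and_norm_truncAction_le hM he _
      hc.abs_sub_zero_le state_le action_le

lemma abs_integral_pathCost_sub_surrogateCost_le (S : StableSystem A B 𝕂 κB κ γ)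
    (hw : NoiseProcess P 𝒟 σ W w) (hc : CostClass α G c) {M : Params H du dx}
    (hM : M ∈ feasible H du dx κB κ γ) {t : ℕ}
    (hπ : BoundedPolicy A B W (W * stateGain γ⁻¹ κB κ) π t) :
    |∫ ω, pathCost A B c π (fun s => w s ω) t ∂P - surrogateCost A B 𝕂 𝒟 c M| ≤
      4 * G * (W * stateGain γ⁻¹ κB κ) ^ 2 := by
  have path_le := abs_integral_pathCost_sub_zero_le hw hc hπ
  have surrogate_le := S.abs_surrogateCost_sub_zero_le hw hc hM
  rw [abs_sub_comm] at surrogate_le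
  linarith [abs_sub_le (∫ ω, pathCost A B c π (fun s => w s ω) t ∂P) (c 0 0)
    (surrogateCost A B 𝕂 𝒟 c M)]

lemma abs_integral_pathCost_sub_surrogateCost_le_of_norm_sub_le (S : StableSystem A B 𝕂 κB κ γ)
    (hw : NoiseProcess P 𝒟 σ W w) (hc : CostClass α G c) {M : Params H du dx}
    (hM : M ∈ feasible H du dx κB κ γ) {t : ℕ} (ht : 2 * H + 1 ≤ t)
    (hπ : BoundedPolicy A B W (W * stateGain γ⁻¹ κB κ) π t) {ε : ℝ}
    (hε : ∀ e, (∀ s, ‖e s‖ ≤ W) → ‖states A B (π e) e t - truncState A B 𝕂 M e t‖ +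
      ‖π e t (states A B (π e) e t) - truncAction A B 𝕂 M e t‖ ≤ ε) :
    |∫ ω, pathCost A B c π (fun s => w s ω) t ∂P - surrogateCost A B 𝕂 𝒟 c M| ≤
      G * (W * stateGain γ⁻¹ κB κ) * ε := by
  have := hc.G_nonneg
  have := hw.law.W_nonneg
  have := S.stateGain_pos
  rw [surrogateCost_eq_expectation hw.measurable hw.map_eq hw.indep hc M ht]
  refine hw.abs_integral_sub_integral_le (hπ.continuous_pathCost hc)
    (hc.continuous_truncCost M t) fun e he => ?_
  obtain ⟨trunc_state_le, trunc_action_le⟩ :=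
    S.norm_truncState_le_and_norm_truncAction_le hM he t
  obtain ⟨state_le, action_le⟩ := hπ.norm_le e he
  exact (hc.abs_sub_le state_le trunc_state_le action_le trunc_action_le).trans
    (mul_le_mul_of_nonneg_left (hε e he) (by positivity))

end StableSystem

end StepCosts

section Regret

lemma sum_le_of_le_crude_of_le_fine {g : ℕ → ℝ} {T m : ℕ} {X Y Z : ℝ}
    (hX : 0 ≤ X) (hY : 0 ≤ Y) (hZ : 0 ≤ Z) (crude : ∀ t, 1 ≤ t → t ≤ T → t ≤ m → g t ≤ X)
    (fine : ∀ t, 1 ≤ t → t ≤ T → m < t → g t ≤ Y * (1 / T) + Z * (t : ℝ)⁻¹) :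
    ∑ t ∈ Finset.Icc 1 T, g t ≤ m * X + Y + Z * (1 + Real.log T) := by
  have card_le : (Finset.filter (· ≤ m) (Finset.Icc 1 T)).card ≤ m := by
    refine (Finset.card_le_card (t := Finset.Icc 1 m) fun t ht => ?_).trans_eq (by simp)
    grind
  calc ∑ t ∈ Finset.Icc 1 T, g t
      ≤ ∑ t ∈ Finset.Icc 1 T, ((if t ≤ m then X else 0) + Y * (1 / T) + Z * (t : ℝ)⁻¹) := by
        refine Finset.sum_le_sum fun t ht => ?_
        obtain ⟨ht1, htT⟩ := Finset.mem_Icc.mp ht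
        have : 0 ≤ Y * (1 / T) + Z * (t : ℝ)⁻¹ := by positivity
        split_ifs with htm
        · linarith [crude t ht1 htT htm]
        · linarith [fine t ht1 htT (by omega)]
    _ = (Finset.filter (· ≤ m) (Finset.Icc 1 T)).card * X + Y * (T * (1 / T)) +
          Z * ∑ t ∈ Finset.Icc 1 T, (t : ℝ)⁻¹ := by
        rw [Finset.sum_add_distrib, Finset.sum_add_distrib, ← Finset.sum_filter,
          Finset.sum_const, Finset.sum_const, Finset.mul_sum, Nat.card_Icc, nsmul_eq_mul,
          nsmul_eq_mul, Nat.add_sub_cancel, mul_left_comm]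
    _ ≤ m * X + Y * 1 + Z * (1 + Real.log T) := by
        gcongr
        · rw [mul_one_div]
          exact div_self_le_one _
        · exact sum_inv_le_one_add_log T
    _ = _ := by rw [mul_one]

variable {H dx du T : ℕ} {A : Matrix (Fin dx) (Fin dx) ℝ} {B : Matrix (Fin dx) (Fin du) ℝ}
  {𝕂 K : Matrix (Fin du) (Fin dx) ℝ} {κB κ γ W σ α G μ : ℝ}
  {𝒟 : Measure (EuclideanSpace ℝ (Fin dx))} {Ω : Type*} [MeasurableSpace Ω] {P : Measure Ω}
  {w : ℕ → Ω → EuclideanSpace ℝ (Fin dx)}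
  {c : ℕ → EuclideanSpace ℝ (Fin dx) → EuclideanSpace ℝ (Fin du) → ℝ}
  {M : ℕ → Params H du dx}

namespace StableSystem

lemma abs_expectedCost_sub_sum_surrogateCost_le (S : StableSystem A B 𝕂 κB κ γ)
    (hw : NoiseProcess P 𝒟 σ W w) (hT : 1 ≤ T)
    (hc : ∀ t, 1 ≤ t → t ≤ T → CostClass α G (c t))
    (hM : ∀ t, 1 ≤ t → t ≤ T → M t ∈ feasible H du dx κB κ γ)
    {π : (ℕ → EuclideanSpace ℝ (Fin dx)) → ℕ → EuclideanSpace ℝ (Fin dx) →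
      EuclideanSpace ℝ (Fin du)}
    (hπ : ∀ t, 1 ≤ t → t ≤ T → BoundedPolicy A B W (W * stateGain γ⁻¹ κB κ) π t) {Y Z : ℝ}
    (hY : 0 ≤ Y) (hZ : 0 ≤ Z)
    (hε : ∀ t, 2 * H + 2 ≤ t → t ≤ T → ∀ e, (∀ s, ‖e s‖ ≤ W) →
      ‖states A B (π e) e t - truncState A B 𝕂 (M t) e t‖ +
        ‖π e t (states A B (π e) e t) - truncAction A B 𝕂 (M t) e t‖ ≤
        Y * (1 / T) + Z * (t : ℝ)⁻¹) :
    |expectedCost A B P w c T π - ∑ t ∈ Finset.Icc 1 T, surrogateCost A B 𝕂 𝒟 (c t) (M t)| ≤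
      (2 * H + 1) * (4 * G * (W * stateGain γ⁻¹ κB κ) ^ 2) +
        G * (W * stateGain γ⁻¹ κB κ) * Y +
        G * (W * stateGain γ⁻¹ κB κ) * Z * (1 + Real.log T) := by
  have := (hc 1 le_rfl hT).G_nonneg
  have := hw.law.W_nonneg
  have := S.stateGain_pos
  rw [expectedCost_eq_sum hw hc hπ, ← Finset.sum_sub_distrib]
  refine (Finset.abs_sum_le_sum_abs _ _).trans ?_
  exact_mod_cast sum_le_of_le_crude_of_le_fine (m := 2 * H + 1) (by positivity) (by positivity)
    (by positivity)
    (fun t ht htT _ => S.abs_integral_pathCost_sub_surrogateCost_le hw (hc t ht htT)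
      (hM t ht htT) (hπ t ht htT))
    fun t ht htT hHt => (S.abs_integral_pathCost_sub_surrogateCost_le_of_norm_sub_le hw
      (hc t ht htT) (hM t ht htT) hHt.le (hπ t ht htT) (hε t hHt htT)).trans_eq (by ring)

lemma abs_expectedCost_dapPolicy_sub_le (S : StableSystem A B 𝕂 κB κ γ)
    (hw : NoiseProcess P 𝒟 σ W w) (hT : 1 ≤ T) (hH : κ ^ 2 * (1 - γ) ^ H ≤ 1 / T)
    (hc : ∀ t, 1 ≤ t → t ≤ T → CostClass α G (c t))
    (hM : ∀ t, 1 ≤ t → t ≤ T → M t ∈ feasible H du dx κB κ γ) {Z : ℝ} (hZ : 0 ≤ Z)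
    (hδ : ∀ s t, 1 ≤ s → s ≤ t → t ≤ T → t ≤ s + (H + 1) → t ≤ 2 * s →
      ‖M s - M t‖ ≤ Z * (t : ℝ)⁻¹) :
    |expectedCost A B P w c T (dapPolicy 𝕂 M) -
        ∑ t ∈ Finset.Icc 1 T, surrogateCost A B 𝕂 𝒟 (c t) (M t)| ≤
      (2 * H + 1) * (4 * G * (W * stateGain γ⁻¹ κB κ) ^ 2) +
        G * (W * stateGain γ⁻¹ κB κ) * ((1 + κ) * (W * stateGain γ⁻¹ κB κ)) +
        G * (W * stateGain γ⁻¹ κB κ) * (lipGain γ⁻¹ κB κ * (W * H * Z)) *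
          (1 + Real.log T) := by
  have := S.kappa_pos
  have := S.stateGain_pos
  have := S.lipGain_pos
  have := hw.law.W_nonneg
  refine S.abs_expectedCost_sub_sum_surrogateCost_le hw hT hc hM
    (fun t => S.boundedPolicy_dapPolicy hM) (by positivity) (by positivity)
    fun t hHt htT e he => ?_
  refine (S.norm_dapPolicy_sub_trunc_le he hM hHt htT fun s hs hst =>
    hδ s t (by omega) hst htT (by omega) (by omega)).trans ?_
  calc _ ≤ (1 + κ) * (1 / T * (W * stateGain γ⁻¹ κB κ)) +
        lipGain γ⁻¹ κB κ * (W * H * (Z * (t : ℝ)⁻¹)) := by gcongr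
    _ = _ := by ring

lemma abs_expectedCost_linearPolicy_sub_le (S : StableSystem A B 𝕂 κB κ γ)
    (hw : NoiseProcess P 𝒟 σ W w) (hT : 1 ≤ T) (hH : κ ^ 2 * (1 - γ) ^ H ≤ 1 / T)
    (hc : ∀ t, 1 ≤ t → t ≤ T → CostClass α G (c t)) (hK : PowerStable A B κ γ K) :
    |expectedCost A B P w c T (fun _ => linearPolicy K) -
        ∑ t ∈ Finset.Icc 1 T, surrogateCost A B 𝕂 𝒟 (c t) (imitation A B 𝕂 K H)| ≤
      (2 * H + 1) * (4 * G * (W * stateGain γ⁻¹ κB κ) ^ 2) +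
        G * (W * stateGain γ⁻¹ κB κ) *
          ((1 + κ + 2 * κ * lipGain γ⁻¹ κB κ) * (W * stateGain γ⁻¹ κB κ)) := by
  have := S.kappa_pos
  have := S.stateGain_pos
  have := S.lipGain_pos
  have := hw.law.W_nonneg
  refine (S.abs_expectedCost_sub_sum_surrogateCost_le hw hT hc (Z := 0)
    (Y := (1 + κ + 2 * κ * lipGain γ⁻¹ κB κ) * (W * stateGain γ⁻¹ κB κ))
    (fun _ _ _ => S.imitation_mem_feasible hK)
    (fun t ht _ => boundedPolicy_linearPolicy { S with stable := hK } ht)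
    (by positivity) le_rfl fun t hHt _ e he => ?_).trans_eq (by ring)
  refine (S.norm_linearPolicy_sub_trunc_le hK he hHt).trans ?_
  calc _ ≤ (1 + κ + 2 * κ * lipGain γ⁻¹ κB κ) * (1 / T * (W * stateGain γ⁻¹ κB κ)) := by gcongr
    _ = _ := by ring

end StableSystem

namespace IsGradientRun

lemma mem_feasible {η : ℕ → ℝ} (h : IsGradientRun A B 𝕂 κB κ γ 𝒟 c T η M) {t : ℕ}
    (ht : 1 ≤ t) (htT : t ≤ T) : M t ∈ feasible H du dx κB κ γ := by
  cases t, ht using Nat.le_induction with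
  | base => exact h.1
  | succ t ht => exact (h.2 t ht htT).1

lemma norm_sub_le (h : IsGradientRun A B 𝕂 κB κ γ 𝒟 c T (fun t => (μ * t)⁻¹) M)
    (S : StableSystem A B 𝕂 κB κ γ) (h𝒟 : NoiseLaw 𝒟 σ W)
    (hc : ∀ t, 1 ≤ t → t ≤ T → CostClass α G (c t)) (hμ : 0 < μ) {s t : ℕ} (hs : 1 ≤ s)
    (hst : s ≤ t) (htT : t ≤ T) (hts : t ≤ s + (H + 1)) (hts' : t ≤ 2 * s) :
    ‖M s - M t‖ ≤ (H + 1) * (4 / μ * surrogateLip γ⁻¹ κB κ G W H) * (t : ℝ)⁻¹ := by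
  have := S.surrogateLip_nonneg (W := W) (H := H) (hc s hs (hst.trans htT)).G_nonneg
  refine (norm_iterate_sub_le hμ (fun _ => h.mem_feasible) (fun t ht htT => (h.2 t ht htT).2)
    (fun t ht htT => S.norm_gradient_surrogateCost_le (hc t ht htT) h𝒟 (h.mem_feasible ht htT))
    hs hst htT hts').trans ?_
  have sub_le : ((t - s : ℕ) : ℝ) ≤ H + 1 := by exact_mod_cast (by omega : t - s ≤ H + 1)
  rw [mul_assoc ((H : ℝ) + 1)]
  gcongr

lemma sum_surrogateCost_sub_le (h : IsGradientRun A B 𝕂 κB κ γ 𝒟 c T (fun t => (μ * t)⁻¹) M)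
    (S : StableSystem A B 𝕂 κB κ γ) (h𝒟 : NoiseLaw 𝒟 σ W)
    (hc : ∀ t, 1 ≤ t → t ≤ T → CostClass α G (c t)) (hα : 0 ≤ α) (hμ : 0 < μ)
    (hμ' : μ ≤ α * σ ^ 2 / (2 * κ ^ 2)) {N : Params H du dx}
    (hN : N ∈ feasible H du dx κB κ γ) :
    ∑ t ∈ Finset.Icc 1 T,
        (surrogateCost A B 𝕂 𝒟 (c t) (M t) - surrogateCost A B 𝕂 𝒟 (c t) N) ≤
      surrogateLip γ⁻¹ κB κ G W H ^ 2 / (2 * μ) * (1 + Real.log T) :=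
  sum_sub_le_of_projected_gradient_descent (convex_feasible κB κ γ) hμ hN h.2
    (fun t ht htT => S.norm_gradient_surrogateCost_le (hc t ht htT) h𝒟 (h.mem_feasible ht htT))
    fun t ht htT => sub_le_inner_gradient_sub_of_strongConvexOn
      ((S.strongConvexOn_surrogateCost hα (hc t ht htT) h𝒟).mono hμ')
      (S.differentiableAt_surrogateCost (hc t ht htT) h𝒟 (h.mem_feasible ht htT))
      (Set.mem_univ _) (Set.mem_univ _)

lemma regret_le (h : IsGradientRun A B 𝕂 κB κ γ 𝒟 c T (fun t => (μ * t)⁻¹) M)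
    (S : StableSystem A B 𝕂 κB κ γ) (hw : NoiseProcess P 𝒟 σ W w) (hT : 1 ≤ T)
    (hH : κ ^ 2 * (1 - γ) ^ H ≤ 1 / T) (hc : ∀ t, 1 ≤ t → t ≤ T → CostClass α G (c t))
    (hα : 0 ≤ α) (hμ : 0 < μ) (hμ' : μ ≤ α * σ ^ 2 / (2 * κ ^ 2)) (hK : PowerStable A B κ γ K) :
    expectedCost A B P w c T (dapPolicy 𝕂 M) -
        expectedCost A B P w c T (fun _ => linearPolicy K) ≤
      8 * (G * W ^ 2 * stateGain γ⁻¹ κB κ ^ 2) * (2 * H + 1) +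
      G * W ^ 2 * stateGain γ⁻¹ κB κ ^ 2 * (2 + 2 * κ + 2 * κ * lipGain γ⁻¹ κB κ) +
      G ^ 2 * W ^ 4 / μ * (stateGain γ⁻¹ κB κ * lipGain γ⁻¹ κB κ * H) ^ 2 * (8 * H + 10) *
        (1 + Real.log T) := by
  have := S.surrogateLip_nonneg (W := W) (H := H) (hc 1 le_rfl hT).G_nonneg
  have descent := h.sum_surrogateCost_sub_le S hw.law hc hα hμ hμ'
    (S.imitation_mem_feasible hK)
  have dap_gap := abs_le.mp <| S.abs_expectedCost_dapPolicy_sub_le hw hT hH hc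
    (fun _ => h.mem_feasible) (by positivity) fun s t => h.norm_sub_le S hw.law hc hμ
  have linear_gap := abs_le.mp (S.abs_expectedCost_linearPolicy_sub_le hw hT hH hc hK)
  rw [Finset.sum_sub_distrib] at descent
  set D := W * stateGain γ⁻¹ κB κ with hD
  set ℓ := surrogateLip γ⁻¹ κB κ G W H with hℓ
  calc _ ≤ (2 * H + 1) * (4 * G * D ^ 2) + G * D * ((1 + κ) * D) +
          G * D * (lipGain γ⁻¹ κB κ * (W * H * ((H + 1) * (4 / μ * ℓ)))) * (1 + Real.log T) +
          ℓ ^ 2 / (2 * μ) * (1 + Real.log T) +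
          ((2 * H + 1) * (4 * G * D ^ 2) +
            G * D * ((1 + κ + 2 * κ * lipGain γ⁻¹ κB κ) * D)) := by
        linarith [dap_gap.2, linear_gap.1]
    _ = _ := by
        rw [hℓ, hD, surrogateLip]
        field_simp
        ring

end IsGradientRun

end Regret

section Constants

variable {κ γ : ℝ} {T : ℕ}

/-- The horizon is at most `horizonGain γ⁻¹ κ * log T` for `T ≥ 2`. -/
def horizonGain {R : Type*} [CommSemiring R] (g κ : R) : R := g * (1 + 4 * κ) + 2

/-- The factor of the regret bound that depends only on the system. -/
def regretGain {R : Type*} [CommSemiring R] (g κB κ : R) : R :=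
  stateGain g κB κ ^ 2 * (3072 * (2 * horizonGain g κ + 2) +
    768 * (2 + 2 * κ + 2 * κ * lipGain g κB κ) +
    24 * (lipGain g κB κ * horizonGain g κ) ^ 2 * (8 * horizonGain g κ + 20))

lemma half_le_log (hT : 2 ≤ T) : 1 / 2 ≤ Real.log T := by
  have log_two_le : Real.log 2 ≤ Real.log T :=
    Real.log_le_log (by norm_num) (by exact_mod_cast hT)
  linarith [Real.log_two_gt_d9]

lemma horizon_le (hκ : 1 ≤ κ) (hγ : 0 < γ) (hT : 2 ≤ T) :
    (horizon κ γ T : ℝ) ≤ horizonGain γ⁻¹ κ * Real.log T := by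
  have half_le := half_le_log hT
  have hT' : (T : ℝ) ≠ 0 := by positivity
  have log_kappa_nonneg := Real.log_nonneg hκ
  have log_kappa_le : Real.log κ ≤ κ := Real.log_le_self (by linarith)
  have log_mul : Real.log (T * κ ^ 2) = Real.log T + 2 * Real.log κ := by
    rw [Real.log_mul hT' (by positivity), Real.log_pow, Nat.cast_two]
  have log_mul_le : Real.log (T * κ ^ 2) ≤ (1 + 4 * κ) * Real.log T := by
    rw [log_mul]
    nlinarith
  calc (horizon κ γ T : ℝ) ≤ γ⁻¹ * Real.log (T * κ ^ 2) + 1 :=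
        (Nat.ceil_lt_add_one (by rw [log_mul]; positivity)).le
    _ ≤ γ⁻¹ * ((1 + 4 * κ) * Real.log T) + 2 * Real.log T := by
        gcongr
        linarith
    _ = horizonGain γ⁻¹ κ * Real.log T := by rw [horizonGain]; ring

lemma mul_pow_le_mul_pow_seven {x C : ℝ} {k : ℕ} (hk : k ≤ 7) (hC : 0 ≤ C) (hx : 1 / 2 ≤ x) :
    C * x ^ k ≤ C * 2 ^ (7 - k) * x ^ 7 := by
  have one_le : 1 ≤ (2 * x) ^ (7 - k) := one_le_pow₀ (by linarith)
  have : 0 ≤ x := by linarith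
  calc C * x ^ k ≤ C * x ^ k * (2 * x) ^ (7 - k) := le_mul_of_one_le_right (by positivity) one_le
    _ = C * 2 ^ (7 - k) * (x ^ k * x ^ (7 - k)) := by rw [mul_pow]; ring
    _ = C * 2 ^ (7 - k) * x ^ 7 := by rw [← pow_add, Nat.add_sub_cancel' hk]

lemma regret_terms_le {g κB r ρ h x : ℝ} (hκ : 0 ≤ κ) (hl : 0 ≤ lipGain g κB κ) (hr : r ≤ 6 * ρ)
    (hρ : 0 ≤ ρ) (hx : 1 / 2 ≤ x) (hh : 0 ≤ h) (hh' : 0 ≤ horizonGain g κ)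
    (hhx : h ≤ horizonGain g κ * x) :
    8 * (r * stateGain g κB κ ^ 2) * (2 * h + 1) +
        r * stateGain g κB κ ^ 2 * (2 + 2 * κ + 2 * κ * lipGain g κB κ) +
        ρ * (stateGain g κB κ * lipGain g κB κ * h) ^ 2 * (8 * h + 10) * (1 + x) ≤
      regretGain g κB κ * ρ * x ^ 7 := by
  rw [regretGain]
  set a := stateGain g κB κ
  set l := lipGain g κB κ
  set h' := horizonGain g κ
  have : 0 ≤ x := by linarith
  have first : 8 * (r * a ^ 2) * (2 * h + 1) ≤ ρ * a ^ 2 * (3072 * (2 * h' + 2)) * x ^ 7 :=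
    calc 8 * (r * a ^ 2) * (2 * h + 1) ≤ 8 * (6 * ρ * a ^ 2) * ((2 * h' + 2) * x) := by
          gcongr
          linarith
      _ = ρ * a ^ 2 * (48 * (2 * h' + 2)) * x ^ 1 := by ring
      _ ≤ _ := mul_pow_le_mul_pow_seven (by norm_num) (by positivity) hx
      _ = _ := by ring
  have second : r * a ^ 2 * (2 + 2 * κ + 2 * κ * l) ≤
      ρ * a ^ 2 * (768 * (2 + 2 * κ + 2 * κ * l)) * x ^ 7 :=
    calc r * a ^ 2 * (2 + 2 * κ + 2 * κ * l) ≤ 6 * ρ * a ^ 2 * (2 + 2 * κ + 2 * κ * l) := by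
          gcongr
      _ = ρ * a ^ 2 * (6 * (2 + 2 * κ + 2 * κ * l)) * x ^ 0 := by ring
      _ ≤ _ := mul_pow_le_mul_pow_seven (by norm_num) (by positivity) hx
      _ = _ := by ring
  have third : ρ * (a * l * h) ^ 2 * (8 * h + 10) * (1 + x) ≤
      ρ * a ^ 2 * (24 * (l * h') ^ 2 * (8 * h' + 20)) * x ^ 7 :=
    calc ρ * (a * l * h) ^ 2 * (8 * h + 10) * (1 + x)
        = ρ * a ^ 2 * (l * h) ^ 2 * (8 * h + 10) * (1 + x) := by ring
      _ ≤ ρ * a ^ 2 * (l * (h' * x)) ^ 2 * ((8 * h' + 20) * x) * (3 * x) := by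
          gcongr <;> linarith
      _ = ρ * a ^ 2 * (3 * (l * h') ^ 2 * (8 * h' + 20)) * x ^ 4 := by ring
      _ ≤ _ := mul_pow_le_mul_pow_seven (by norm_num) (by positivity) hx
      _ = _ := by ring
  linarith

end Constants

section LogarithmicRegret

variable {H dx du T : ℕ} {A : Matrix (Fin dx) (Fin dx) ℝ} {B : Matrix (Fin dx) (Fin du) ℝ}
  {𝕂 K : Matrix (Fin du) (Fin dx) ℝ} {κB κ γ W σ α G μ : ℝ}
  {𝒟 : Measure (EuclideanSpace ℝ (Fin dx))} {Ω : Type*} [MeasurableSpace Ω] {P : Measure Ω}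
  {w : ℕ → Ω → EuclideanSpace ℝ (Fin dx)}
  {c : ℕ → EuclideanSpace ℝ (Fin dx) → EuclideanSpace ℝ (Fin du) → ℝ}

lemma expectedCost_eq_of_one (M : ℕ → Params H du dx) :
    expectedCost A B P w c 1 (dapPolicy 𝕂 M) =
      expectedCost A B P w c 1 (fun _ => linearPolicy K) := by
  have dapPolicy_one v : dapPolicy 𝕂 M v 1 0 = 0 := by
    rw [dapPolicy, map_zero, neg_zero, zero_add]
    refine Finset.sum_eq_zero fun i hi => if_neg ?_
    have := Finset.mem_Icc.mp hi
    omega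
  simp [expectedCost, states, linearPolicy, dapPolicy_one]

lemma expectedCost_eq_of_isEmpty [IsEmpty (Fin dx)] (M : ℕ → Params H du dx) :
    expectedCost A B P w c T (dapPolicy 𝕂 M) =
      expectedCost A B P w c T (fun _ => linearPolicy K) := by
  have map_eq_zero (L : Matrix (Fin du) (Fin dx) ℝ) (x : EuclideanSpace ℝ (Fin dx)) :
      L.toEuclideanLin x = 0 := by rw [Subsingleton.elim x 0, map_zero]
  have dapPolicy_eq_zero v t x : dapPolicy 𝕂 M v t x = 0 := by
    simp only [dapPolicy, map_eq_zero, neg_zero, zero_add, ite_self, Finset.sum_const_zero]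
  have linearPolicy_eq_zero t x : linearPolicy K t x = 0 := by
    rw [linearPolicy, map_eq_zero, neg_zero]
  simp only [expectedCost, dapPolicy_eq_zero, linearPolicy_eq_zero,
    Subsingleton.elim (states A B _ _ _) 0]

lemma StableSystem.horizonGain_nonneg (S : StableSystem A B 𝕂 κB κ γ) :
    0 ≤ horizonGain γ⁻¹ κ := by
  have := S.kappa_pos
  have := S.inv_pos
  unfold horizonGain
  positivity

lemma StableSystem.regretGain_nonneg (S : StableSystem A B 𝕂 κB κ γ) :
    0 ≤ regretGain γ⁻¹ κB κ := by
  have := S.stateGain_pos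
  have := S.lipGain_pos
  have := S.kappa_pos
  have := S.horizonGain_nonneg
  unfold regretGain
  positivity

lemma mul_sq_le_of_costClass_of_noiseLaw {c : EuclideanSpace ℝ (Fin dx) →
    EuclideanSpace ℝ (Fin du) → ℝ} (hdx : 0 < dx) (hc : CostClass α G c) (h𝒟 : NoiseLaw 𝒟 σ W)
    (hμ : 0 < μ) (hμ' : μ ≤ α * σ ^ 2) : G * W ^ 2 ≤ 6 * (G ^ 2 * W ^ 4 / μ) := by
  have hG := hc.G_nonneg
  have le_six : μ ≤ 6 * G * W ^ 2 := hμ'.trans <| mul_le_mul (hc.alpha_le hdx)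
    (h𝒟.sigma_sq_le hdx) (sq_nonneg σ) (by positivity)
  rw [← mul_div_assoc, le_div_iff₀ hμ]
  calc G * W ^ 2 * μ ≤ G * W ^ 2 * (6 * G * W ^ 2) := by gcongr
    _ = 6 * (G ^ 2 * W ^ 4) := by ring

lemma IsGradientRun.regret_le_log_pow {M : ℕ → Params (horizon κ γ T) du dx}
    (h : IsGradientRun A B 𝕂 κB κ γ 𝒟 c T (fun t => (μ * t)⁻¹) M)
    (S : StableSystem A B 𝕂 κB κ γ) (hw : NoiseProcess P 𝒟 σ W w) (hT : 1 ≤ T)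
    (hc : ∀ t, 1 ≤ t → t ≤ T → CostClass α G (c t)) (hα : 0 ≤ α) (hμ : 0 < μ)
    (hμ' : μ ≤ α * σ ^ 2 / (2 * κ ^ 2)) (hK : PowerStable A B κ γ K) :
    expectedCost A B P w c T (dapPolicy 𝕂 M) -
        expectedCost A B P w c T (fun _ => linearPolicy K) ≤
      regretGain γ⁻¹ κB κ * (G ^ 2 * W ^ 4 / μ) * Real.log T ^ 7 := by
  have bound_nonneg : 0 ≤ regretGain γ⁻¹ κB κ * (G ^ 2 * W ^ 4 / μ) * Real.log T ^ 7 := by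
    have := S.regretGain_nonneg
    have := Real.log_natCast_nonneg T
    positivity
  rcases isEmpty_or_nonempty (Fin dx) with _ | ⟨⟨_, hdx⟩⟩
  · rwa [expectedCost_eq_of_isEmpty, sub_self]
  rcases hT.eq_or_lt with rfl | hT2
  · rwa [expectedCost_eq_of_one, sub_self]
  have le_mul : μ ≤ α * σ ^ 2 := hμ'.trans <|
    div_le_self (by positivity) (by linarith [one_le_pow₀ (n := 2) S.one_le])
  exact (h.regret_le S hw hT (one_sub_pow_horizon_le S.kappa_pos S.pos S.le_one hT) hc hα hμ hμ'
    hK).trans <| regret_terms_le S.kappa_pos.le S.lipGain_pos.le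
      (mul_sq_le_of_costClass_of_noiseLaw (Nat.zero_lt_of_lt hdx) (hc 1 le_rfl hT) hw.law hμ
        le_mul) (by positivity) (half_le_log hT2) (Nat.cast_nonneg _) S.horizonGain_nonneg
      (horizon_le S.one_le S.pos hT2)

lemma map_regretGain {R R' : Type*} [CommSemiring R] [CommSemiring R'] (f : R →+* R')
    (g κB κ : R) : f (regretGain g κB κ) = regretGain (f g) (f κB) (f κ) := by
  simp only [regretGain, stateGain, lipGain, feedforwardGain, horizonGain, map_add, map_mul,
    map_pow, map_one, map_ofNat]

end LogarithmicRegret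

end OnlineControl

end

open OnlineControl in
theorem theorem1_general {dx du : ℕ} {A : Matrix (Fin dx) (Fin dx) ℝ}
    {B : Matrix (Fin dx) (Fin du) ℝ} {κB κ γ σ W α G θ : ℝ} {T : ℕ} {Ω : Type*}
    [MeasurableSpace Ω] {P : Measure Ω} {𝒟 : Measure (EuclideanSpace ℝ (Fin dx))}
    {w : ℕ → Ω → EuclideanSpace ℝ (Fin dx)}
    {c : ℕ → EuclideanSpace ℝ (Fin dx) → EuclideanSpace ℝ (Fin du) → ℝ}
    {𝕂 K : Matrix (Fin du) (Fin dx) ℝ} {M : ℕ → Params (horizon κ γ T) du dx}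
    (hκ : 1 ≤ κ) (hγ : 0 < γ) (hγ1 : γ ≤ 1) (hσ : 0 < σ) (hα : 0 < α) (hT : 1 ≤ T)
    (hB : specNorm B ≤ κB) (h𝒟 : NoiseLaw 𝒟 σ W) (hw : ∀ t, Measurable (w t))
    (hmap : ∀ t, P.map (w t) = 𝒟) (hindep : iIndepFun w P)
    (hc : ∀ t, 1 ≤ t → t ≤ T → CostClass α G (c t)) (h𝕂 : PowerStable A B κ γ 𝕂)
    (hθ : 2 * κ ^ 2 ≤ θ)
    (hM : IsGradientRun A B 𝕂 κB κ γ 𝒟 c T (fun t => θ / (α * σ ^ 2 * t)) M)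
    (hK : PowerStable A B κ γ K) :
    expectedCost A B P w c T (dapPolicy 𝕂 M) -
        expectedCost A B P w c T (fun _ => linearPolicy K) ≤
      regretGain γ⁻¹ κB κ * θ * (G ^ 2 * W ^ 4 / (α * σ ^ 2)) * Real.log T ^ 7 := by
  have hθ0 : 0 < θ := lt_of_lt_of_le (by positivity) hθ
  have step_eq (t : ℕ) : θ / (α * σ ^ 2 * t) = (α * σ ^ 2 / θ * t)⁻¹ := by
    rw [div_mul_eq_mul_div, inv_div]
  simp only [step_eq] at hM
  have μ_le : α * σ ^ 2 / θ ≤ α * σ ^ 2 / (2 * κ ^ 2) :=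
    div_le_div_of_nonneg_left (by positivity) (by positivity) hθ
  refine (hM.regret_le_log_pow ⟨hκ, hγ, hγ1, hB, h𝕂⟩ ⟨h𝒟, hw, hmap, hindep⟩ hT hc hα.le
    (by positivity) μ_le hK).trans_eq ?_
  rw [div_div_eq_mul_div, mul_div_right_comm]
  ring

theorem theorem1 :
    ∃ p q : MvPolynomial (Fin 4) ℝ,
      ∀ (dx du : ℕ) (A : Matrix (Fin dx) (Fin dx) ℝ) (B : Matrix (Fin dx) (Fin du) ℝ)
        (κB κ γ σ W α G θ : ℝ) (T : ℕ)
        (Ω : Type*) [MeasurableSpace Ω] (P : Measure Ω) [IsProbabilityMeasure P]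
        (𝒟 : Measure (EuclideanSpace ℝ (Fin dx)))
        (w : ℕ → Ω → EuclideanSpace ℝ (Fin dx))
        (c : ℕ → EuclideanSpace ℝ (Fin dx) → EuclideanSpace ℝ (Fin du) → ℝ)
        (𝕂 : Matrix (Fin du) (Fin dx) ℝ)
        (M : ℕ → OnlineControl.Params (OnlineControl.horizon κ γ T) du dx),
      1 ≤ κ → 0 < γ → γ < 1 → 0 < σ → 0 < α → 1 ≤ T →
      OnlineControl.specNorm B ≤ κB →
      OnlineControl.NoiseLaw 𝒟 σ W →
      (∀ t, Measurable (w t)) → (∀ t, P.map (w t) = 𝒟) → iIndepFun w P →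
      (∀ t, 1 ≤ t → t ≤ T → OnlineControl.CostClass α G (c t)) →
      OnlineControl.DiagStronglyStable A B κ γ 𝕂 →
      MvPolynomial.eval ![γ⁻¹, κB, κ, ((max dx du : ℕ) : ℝ)] p ≤ θ →
      OnlineControl.IsGradientRun A B 𝕂 κB κ γ 𝒟 c T (fun t => θ / (α * σ ^ 2 * t)) M →
      ∀ K : Matrix (Fin du) (Fin dx) ℝ, OnlineControl.DiagStronglyStable A B κ γ K →
        OnlineControl.expectedCost A B P w c T (OnlineControl.dapPolicy 𝕂 M)
          - OnlineControl.expectedCost A B P w c T (fun _ => OnlineControl.linearPolicy K)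
        ≤ MvPolynomial.eval ![γ⁻¹, κB, κ, ((max dx du : ℕ) : ℝ)] q * θ *
          (G ^ 2 * W ^ 4 / (α * σ ^ 2)) * Real.log T ^ 7 := by
  refine ⟨2 * .X 2 ^ 2, OnlineControl.regretGain (.X 0) (.X 1) (.X 2), ?_⟩
  intro dx du A B κB κ γ σ W α G θ T Ω _ P _ 𝒟 w c 𝕂 M hκ hγ hγ1 hσ hα hT hB h𝒟 hw hmap hindep hc
    h𝕂 hθ hM K hK
  simpa [OnlineControl.map_regretGain] using theorem1_general hκ hγ hγ1.le hσ hα hT hB h𝒟 hw hmap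
    hindep hc h𝕂.powerStable (by simpa using hθ) hM hK.powerStable
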